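/- Let $I=[0,1]$ with Lebesgue measure $m$, $|A|=m(A)$, and let $L^1(I)$ be the space of complex integrable functions. Let $0=a_0<\dots<a_N=1$, $I_i=(a_i,a_{i+1})$, let $\beta>0$, and let $T\colon\bigcup_i I_i\to I$ be such that each $T|_{I_i}$ extends to a $C^{1+\beta}$ diffeomorphism of $\overline{I_i}$ onto its image. (A function is $C^{1+\beta}$ if it is $C^k$ and its $k$-th derivative is $(1+\beta-k)$-Hölder, where $k$ is the largest integer smaller than $1+\beta$.) Suppose that $m$ is $T$-invariant. The transfer operator $\mathcal L$ of $T$ with respect to $m$ is given by $\int_I \mathcal Lf\cdot g\,dm=\int_I f\cdot (g\circ T)\,dm$ for $f\in L^1(I)$ and all bounded measurable $g$. Let $\mathcal P^k$ be the set of intervals of monotonicity of $T^k$, i.e. of the nonempty sets $\{x\in I: T^jx\in I_{w_j},\ 0\le j<k\}$ with $w_0,\dots,w_{k-1}\in\{0,\dots,N-1\}$, and put $$\Theta^k(\gamma)=\sum_{J\in\mathcal P^k}\Big(\sup_{x\in J}\frac1{|DT^k(x)|}\Big)^{\gamma},\qquad \Theta^\infty(\gamma)=\lim_{k\to\infty}\big(\Theta^k(\gamma)\big)^{1/k}.$$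 Let $B$ be a complex Banach space of functions continuously embedded in $L^1(I)$ with $\mathcal L(B)\subset B$ and such that $L=\mathcal L|_B\colon B\to B$ is bounded. Suppose that there are $C\ge0$ and $s\in(0,1)$ such that for every interval $J\subset I$ we have $1_J\in B$ and $\|1_J\|_B\le C|J|^{1-s}$. Let $B^s_{1,1}$ be the space of all $\psi\in L^1(I)$ of the form $\psi=\sum_{n\ge0}c_n|Q_n|^{s-1}1_{Q_n}$ (convergence in $L^1(I)$) with intervals $Q_n\subset I$ and $c_n\in\mathbb C$, $\sum_n|c_n|<\infty$, normed by the infimum of $\sum_n|c_n|$ over all such representations. Then $B^s_{1,1}$ is continuously embedded in $B$: $B^s_{1,1}\subset B$ and there is $K$ with $\|\psi\|_B\le K\|\psi\|_{B^s_{1,1}}$ for all $\psi\in B^s_{1,1}$. Moreover, the limit $\Theta^\infty(1-s)$ exists and is positive. If furthermore $s<\beta$ and $|DT(x)|>1$ for at least one $x\in\bigcup_i I_i$ (as is the case when $T$ is expanding), then $$r_{ess}(L,B)\ge \frac1{\Theta^\infty(1-s)},$$ where $r_{ess}(L,B)=\sup\{|\lambda|:\lambda-L\text{ is not a Fredholm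 operator on }B\}$, and every $\lambda\in\mathbb C$ with $|\lambda|<1/\Theta^\infty(1-s)$ is an eigenvalue of $L$ on $B$ with an infinite-dimensional eigenspace. -/

import Mathlib

open MeasureTheory Filter Topology Set
open scoped ENNReal

namespace TransferBesov

noncomputable section

/-- Lebesgue measure on the interval `I = [0,1]`. -/
abbrev mI : Measure ℝ := volume.restrict (Icc (0 : ℝ) 1)

/-- The complex Banach space `L¹(I)`. -/
abbrev L1I : Type := Lp ℂ 1 mI

/-! ### Piecewise smooth maps -/

/-- The function `g` is of class `C^{1+β}` on `[u,v]` (for `β > 0`): with `k` the largest integer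
smaller than `1 + β`, it is `C^k` on `[u,v]` and its `k`-th derivative is Hölder of
exponent `1 + β - k`.  For `0 < β ≤ 1` this says that `g` is `C^1` with `β`-Hölder derivative. -/
def IsC1PlusOn (β : ℝ) (g : ℝ → ℝ) (u v : ℝ) : Prop :=
  ContDiffOn ℝ (⌈β⌉₊ : ℕ) g (Icc u v) ∧
  ∃ H : ℝ, ∀ x ∈ Icc u v, ∀ y ∈ Icc u v,
    |iteratedDerivWithin ⌈β⌉₊ g (Icc u v) x - iteratedDerivWithin ⌈β⌉₊ g (Icc u v) y|
      ≤ H * |x - y| ^ (1 + β - (⌈β⌉₊ : ℝ))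

/-- The open interval `I_i = (a_i, a_{i+1})` of the partition with endpoints `a`. -/
def piece {N : ℕ} (a : Fin (N + 1) → ℝ) (i : Fin N) : Set ℝ :=
  Ioo (a i.castSucc) (a i.succ)

/-- `T` is a piecewise `C^{1+β}` diffeomorphism with respect to the partition of `[0,1]`
with endpoints `0 = a_0 < ⋯ < a_N = 1`: it maps each `I_i` into `[0,1]`, and on each `I_i` it is the
restriction of a `C^{1+β}` diffeomorphism of the closure of `I_i` onto its image.
The values of `T` outside the union of the `I_i` play no role. -/
structure IsPiecewiseDiffeo (β : ℝ) {N : ℕ} (a : Fin (N + 1) → ℝ) (T : ℝ → ℝ) : Prop where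
  strictMono : StrictMono a
  first : a 0 = 0
  last : a (Fin.last N) = 1
  mapsTo : ∀ i, MapsTo T (piece a i) (Icc 0 1)
  extends' : ∀ i, ∃ g : ℝ → ℝ, EqOn g T (piece a i) ∧
    IsC1PlusOn β g (a i.castSucc) (a i.succ) ∧
    ∀ x ∈ Icc (a i.castSucc) (a i.succ),
      derivWithin g (Icc (a i.castSucc) (a i.succ)) x ≠ 0

/-- Lebesgue measure on `[0,1]` is invariant under `T : ⋃ I_i → [0,1]`. -/
def PreservesLebesgue {N : ℕ} (a : Fin (N + 1) → ℝ) (T : ℝ → ℝ) : Prop :=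
  ∀ A : Set ℝ, MeasurableSet A → A ⊆ Icc 0 1 →
    volume ((⋃ i, piece a i) ∩ T ⁻¹' A) = volume A

/-! ### Growth of derivatives -/

/-- The cylinder of the word `w = (w_0, …, w_{k-1})`: the points `x` of `[0,1]` with
`T^j x ∈ I_{w_j}` for all `j < k`.  The nonempty ones are the intervals of monotonicity of `T^k`. -/
def cylinder {N : ℕ} (a : Fin (N + 1) → ℝ) (T : ℝ → ℝ) {k : ℕ} (w : Fin k → Fin N) : Set ℝ :=
  {x ∈ Icc (0 : ℝ) 1 | ∀ j : Fin k, T^[j] x ∈ piece a (w j)}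

/-- `θ = sup 1 / |D T^k|` over an interval of monotonicity of `T^k`. -/
def theta {N : ℕ} (a : Fin (N + 1) → ℝ) (T : ℝ → ℝ) {k : ℕ} (w : Fin k → Fin N) : ℝ :=
  sSup ((fun x => 1 / |deriv (T^[k]) x|) '' cylinder a T w)

open Classical in
/-- `Θ^k(γ) = ∑_i (θ_i^k)^γ`, the sum running over the intervals of monotonicity of `T^k`. -/
def Theta {N : ℕ} (a : Fin (N + 1) → ℝ) (T : ℝ → ℝ) (γ : ℝ) (k : ℕ) : ℝ :=
  ∑ w : Fin k → Fin N, if (cylinder a T w).Nonempty then theta a T w ^ γ else 0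

/-- `Θ^∞(γ) = lim_k (Θ^k(γ))^{1/k}`. -/
def ThetaInf {N : ℕ} (a : Fin (N + 1) → ℝ) (T : ℝ → ℝ) (γ : ℝ) : ℝ :=
  limUnder atTop (fun k : ℕ => Theta a T γ k ^ (1 / (k : ℝ)))

/-! ### Transfer operator and essential spectral radius -/

/-- `h ∈ L¹(I)` is the image of `f ∈ L¹(I)` under the transfer operator of `T` with respect to
Lebesgue measure, the pre-adjoint of the Koopman operator `g ↦ g ∘ T` on `L^∞(I)`. -/
def IsTransferImage (T : ℝ → ℝ) (f h : L1I) : Prop :=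
  ∀ g : ℝ → ℂ, Measurable g → (∃ M : ℝ, ∀ x, ‖g x‖ ≤ M) →
    ∫ x, h x * g x ∂mI = ∫ x, f x * g (T x) ∂mI

/-- The essential spectral radius: the supremum of `|z|` over the essential spectrum, that is,
over the `z` for which `z - A` is not a Fredholm operator. -/
def essSpectralRadius {B : Type*} [NormedAddCommGroup B] [NormedSpace ℂ B] (A : B →L[ℂ] B) :
    ℝ≥0∞ :=
  ⨆ z ∈ {z : ℂ | ¬ (z • ContinuousLinearMap.id ℂ B - A).IsFredholm}, (‖z‖₊ : ℝ≥0∞)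

/-! ### The Besov space `B^s_{1,1}(I)` through atoms -/

/-- The class in `L¹(I)` of the indicator function of an interval. -/
def indL1 (Q : Set ℝ) (hQ : Q.OrdConnected) : L1I :=
  indicatorConstLp 1 hQ.measurableSet (measure_ne_top mI Q) (1 : ℂ)

/-- `ψ = ∑ c_n |Q_n|^{s-1} 1_{Q_n}` in `L¹(I)` with `Q_n ⊆ I` intervals and `∑ |c_n| < ∞`. -/
structure IsAtomicRep (s : ℝ) (ψ : L1I) (c : ℕ → ℂ) (Q : ℕ → Set ℝ) : Prop where
  ordConnected : ∀ n, (Q n).OrdConnected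
  subset : ∀ n, Q n ⊆ Icc 0 1
  summable : Summable fun n => ‖c n‖
  tendsto : Tendsto
    (fun m => ∑ n ∈ Finset.range m,
      (c n * ((volume.real (Q n) ^ (s - 1) : ℝ) : ℂ)) • indL1 (Q n) (ordConnected n))
    atTop (𝓝 ψ)

/-- The Besov space `B^s_{1,1}(I)`, as a subset of `L¹(I)`. -/
def besov (s : ℝ) : Set L1I := {ψ | ∃ c Q, IsAtomicRep s ψ c Q}

/-- The norm of `B^s_{1,1}(I)`: the infimum of `∑ |c_n|` over all atomic representations. -/
def besovNorm (s : ℝ) (ψ : L1I) : ℝ :=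
  sInf {r | ∃ c Q, IsAtomicRep s ψ c Q ∧ r = ∑' n, ‖c n‖}

end

end TransferBesov

namespace TransferBesov

/-! ### Branches of T: derivative bounds, Hölder regularity, monotonicity. -/

namespace IsPiecewiseDiffeo

variable {β : ℝ} {N : ℕ} {a : Fin (N + 1) → ℝ} {T : ℝ → ℝ}

/-! Invariance of Lebesgue measure makes the Koopman operator `U f = f ∘ T` an isometry of L¹(I),
and it is a right inverse of the transfer operator. If f is in the kernel of the transfer operator
and v = ∑ z^k U^k f converges in B, then L v = z v, because L kills the first term and shifts the
others. Moreover v - z U v = f, so independent f give independent eigenvectors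
(`exists_eigenvector`).

Convergence holds for |z| < 1/Θ^∞(1-s) as soon as ‖U^k f‖_B ≤ R Θ^k(1-s), the property
`HasBoundedOrbit`. For f = 1_Q, U^k f is the sum of the indicators of the preimages of Q under the
branches of T^k. These are intervals of length at most θ_w |Q|, so the hypothesis on ‖1_J‖_B gives
the bound with R = C|Q|^{1-s} (`hasBoundedOrbit_indL1`). Being linear in f with explicit R, it
passes to sums of indicators with ∑ R finite, in particular to functions on an interval that are
Hölder of exponent above s (`exists_hasBoundedOrbit_of_holder`).

Kernel elements come from two branches: if T maps intervals of two different pieces onto the same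
[p,q], then |DT| restricted to either is sent to 1_[p,q], so their difference is killed. Such pieces
exist because T expands somewhere while preserving measure (`exists_common_image`). Infinitely many
disjoint [p,q] in the overlap give infinitely many independent kernel elements.

The limit Θ^∞ exists by submultiplicativity (Fekete), and the embedding of the Besov space is the
absolute convergence of an atomic series in B. -/

theorem piece_subset (hT : IsPiecewiseDiffeo β a T) (i : Fin N) : piece a i ⊆ Icc 0 1 := by
  intro x hx
  have h0 : a 0 ≤ a i.castSucc := hT.strictMono.monotone (Fin.zero_le _)
  have h1 : a i.succ ≤ a (Fin.last N) := hT.strictMono.monotone (Fin.le_last _)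
  rw [hT.first] at h0
  rw [hT.last] at h1
  exact ⟨h0.trans hx.1.le, hx.2.le.trans h1⟩

theorem eq_of_mem_piece (hT : IsPiecewiseDiffeo β a T) {i j : Fin N} {x : ℝ}
    (hi : x ∈ piece a i) (hj : x ∈ piece a j) : i = j := by
  have key : ∀ i j : Fin N, x ∈ piece a i → x ∈ piece a j → i ≤ j := by
    intro i j hi hj
    by_contra! h
    have : a j.succ ≤ a i.castSucc := hT.strictMono.monotone (Fin.succ_le_castSucc_iff.2 h)
    exact absurd (hi.1.trans hj.2) (not_lt.2 this)
  exact le_antisymm (key i j hi hj) (key j i hj hi)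

theorem castSucc_lt_succ (hT : IsPiecewiseDiffeo β a T) (i : Fin N) :
    a i.castSucc < a i.succ := hT.strictMono i.castSucc_lt_succ

/-- The derivative of `T` on a piece extends continuously, without zeros, to the closed piece. -/
theorem exists_extension (hβ : 0 < β) (hT : IsPiecewiseDiffeo β a T) (i : Fin N) :
    ∃ g : ℝ → ℝ, EqOn g T (piece a i) ∧
      ContDiffOn ℝ (⌈β⌉₊ : ℕ) g (Icc (a i.castSucc) (a i.succ)) ∧
      ContDiffOn ℝ 1 g (Icc (a i.castSucc) (a i.succ)) ∧
      (∃ H : ℝ, ∀ x ∈ Icc (a i.castSucc) (a i.succ), ∀ y ∈ Icc (a i.castSucc) (a i.succ),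
        |iteratedDerivWithin ⌈β⌉₊ g (Icc (a i.castSucc) (a i.succ)) x
          - iteratedDerivWithin ⌈β⌉₊ g (Icc (a i.castSucc) (a i.succ)) y|
          ≤ H * |x - y| ^ (1 + β - (⌈β⌉₊ : ℝ))) ∧
      (∀ x ∈ Icc (a i.castSucc) (a i.succ),
        derivWithin g (Icc (a i.castSucc) (a i.succ)) x ≠ 0) ∧
      ∀ x ∈ piece a i, HasDerivAt T (derivWithin g (Icc (a i.castSucc) (a i.succ)) x) x := by
  obtain ⟨g, hg, ⟨hc, hH⟩, hne⟩ := hT.extends' i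
  have h1 : ContDiffOn ℝ 1 g (Icc (a i.castSucc) (a i.succ)) :=
    hc.of_le (by exact_mod_cast Nat.one_le_iff_ne_zero.2 (Nat.ceil_pos.2 hβ).ne')
  refine ⟨g, hg, hc, h1, hH, hne, fun x hx => ?_⟩
  have hd : HasDerivWithinAt g (derivWithin g (Icc (a i.castSucc) (a i.succ)) x)
      (Icc (a i.castSucc) (a i.succ)) x :=
    (h1.differentiableOn one_ne_zero x (Ioo_subset_Icc_self hx)).hasDerivWithinAt
  refine (hd.hasDerivAt (Icc_mem_nhds hx.1 hx.2)).congr_of_eventuallyEq ?_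
  filter_upwards [isOpen_Ioo.mem_nhds hx] with y hy
  exact (hg hy).symm

theorem differentiableAt (hβ : 0 < β) (hT : IsPiecewiseDiffeo β a T) {i : Fin N} {x : ℝ}
    (hx : x ∈ piece a i) : DifferentiableAt ℝ T x := by
  obtain ⟨g, -, -, -, -, -, h⟩ := hT.exists_extension hβ i
  exact (h x hx).differentiableAt

theorem continuousOn (hβ : 0 < β) (hT : IsPiecewiseDiffeo β a T) (i : Fin N) :
    ContinuousOn T (piece a i) :=
  fun _ hx => (hT.differentiableAt hβ hx).continuousAt.continuousWithinAt

theorem exists_deriv_bounds (hβ : 0 < β) (hT : IsPiecewiseDiffeo β a T) :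
    ∃ c M : ℝ, 0 < c ∧ 0 < M ∧
      ∀ i, ∀ x ∈ piece a i, c ≤ |deriv T x| ∧ |deriv T x| ≤ M := by
  have key : ∀ i, ∃ c M : ℝ, 0 < c ∧ 0 < M ∧
      ∀ x ∈ piece a i, c ≤ |deriv T x| ∧ |deriv T x| ≤ M := by
    intro i
    obtain ⟨g, -, -, h1, -, hne, hd⟩ := hT.exists_extension hβ i
    have hlt := hT.castSucc_lt_succ i
    have hcont : ContinuousOn (fun x => |derivWithin g (Icc (a i.castSucc) (a i.succ)) x|)
        (Icc (a i.castSucc) (a i.succ)) :=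
      (h1.continuousOn_derivWithin (uniqueDiffOn_Icc hlt) le_rfl).abs
    obtain ⟨p, hp, hpm⟩ := isCompact_Icc.exists_isMinOn (nonempty_Icc.2 hlt.le) hcont
    obtain ⟨q, hq, hqm⟩ := isCompact_Icc.exists_isMaxOn (nonempty_Icc.2 hlt.le) hcont
    refine ⟨_, _, abs_pos.2 (hne p hp), abs_pos.2 (hne q hq), fun x hx => ?_⟩
    rw [(hd x hx).deriv]
    exact ⟨hpm (Ioo_subset_Icc_self hx), hqm (Ioo_subset_Icc_self hx)⟩
  choose c M hc hM h using key
  have hN : (Finset.univ : Finset (Fin N)).Nonempty := by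
    rcases N with _ | N
    · have h0 := hT.first
      have h1 := hT.last
      rw [show Fin.last 0 = 0 from rfl, h0] at h1
      exact absurd h1 zero_ne_one
    · exact Finset.univ_nonempty
  refine ⟨Finset.univ.inf' hN c, Finset.univ.sup' hN M, ?_, ?_, fun i x hx => ⟨?_, ?_⟩⟩
  · exact (Finset.lt_inf'_iff hN).2 fun i _ => hc i
  · obtain ⟨i, hi⟩ := hN
    exact (hM i).trans_le (Finset.le_sup' M hi)
  · exact (Finset.inf'_le c (Finset.mem_univ i)).trans (h i x hx).1
  · exact (h i x hx).2.trans (Finset.le_sup' M (Finset.mem_univ i))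

theorem deriv_ne_zero (hβ : 0 < β) (hT : IsPiecewiseDiffeo β a T) {i : Fin N} {x : ℝ}
    (hx : x ∈ piece a i) : deriv T x ≠ 0 := by
  obtain ⟨c, M, hc, -, h⟩ := hT.exists_deriv_bounds hβ
  exact abs_pos.1 (hc.trans_le (h i x hx).1)

/-- The derivative of `T` is Hölder on each piece, with an exponent above `s`. -/
theorem exists_holder (hβ : 0 < β) (hT : IsPiecewiseDiffeo β a T) {s : ℝ} (hs1 : s < 1)
    (hsβ : s < β) (i : Fin N) :
    ∃ α H : ℝ, s < α ∧ 0 < α ∧ 0 ≤ H ∧ ∀ x ∈ piece a i, ∀ y ∈ piece a i,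
      |(|deriv T x| - |deriv T y|)| ≤ H * |x - y| ^ α := by
  obtain ⟨g, -, hc, h1, ⟨H, hH⟩, -, hd⟩ := hT.exists_extension hβ i
  have hlt := hT.castSucc_lt_succ i
  -- For β ≤ 1 the exponent is β itself. For β > 1 the branch is at least C², so DT is Lipschitz,
  -- and the exponent 1 exceeds s.
  rcases le_or_gt β 1 with hβ1 | hβ1
  · have hk : ⌈β⌉₊ = 1 := by
      rw [Nat.ceil_eq_iff one_ne_zero]; simp [hβ, hβ1]
    refine ⟨β, max H 0, hsβ, hβ, le_max_right _ _, fun x hx y hy => ?_⟩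
    have := hH x (Ioo_subset_Icc_self hx) y (Ioo_subset_Icc_self hy)
    rw [hk, iteratedDerivWithin_one] at this
    rw [(hd x hx).deriv, (hd y hy).deriv]
    refine (abs_abs_sub_abs_le_abs_sub _ _).trans (this.trans ?_)
    rw [show 1 + β - ((1 : ℕ) : ℝ) = β by push_cast; ring]
    gcongr
    exact le_max_left _ _
  · have hk : 2 ≤ ⌈β⌉₊ := Nat.lt_ceil.2 (by simpa using hβ1)
    have h2 : ContDiffOn ℝ 1 (derivWithin g (Icc (a i.castSucc) (a i.succ)))
        (Icc (a i.castSucc) (a i.succ)) :=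
      hc.derivWithin (uniqueDiffOn_Icc hlt) (by exact_mod_cast hk)
    obtain ⟨K, hK⟩ := h2.exists_lipschitzOnWith one_ne_zero (convex_Icc _ _) isCompact_Icc
    refine ⟨1, K, hs1, one_pos, K.2, fun x hx y hy => ?_⟩
    rw [(hd x hx).deriv, (hd y hy).deriv, Real.rpow_one]
    refine (abs_abs_sub_abs_le_abs_sub _ _).trans ?_
    have := hK.dist_le_mul x (Ioo_subset_Icc_self hx) y (Ioo_subset_Icc_self hy)
    rwa [Real.dist_eq, Real.dist_eq] at this

theorem injOn (hβ : 0 < β) (hT : IsPiecewiseDiffeo β a T) (i : Fin N) :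
    InjOn T (piece a i) := by
  have key : ∀ x ∈ piece a i, ∀ y ∈ piece a i, x < y → T x ≠ T y := by
    intro x hx y hy hxy h
    have hsub : Icc x y ⊆ piece a i := (ordConnected_Ioo).out hx hy
    obtain ⟨z, hz, hz'⟩ := exists_deriv_eq_zero hxy ((hT.continuousOn hβ i).mono hsub) h
    exact hT.deriv_ne_zero hβ (hsub (Ioo_subset_Icc_self hz)) hz'
  intro x hx y hy h
  rcases lt_trichotomy x y with hlt | heq | hgt
  · exact absurd h (key x hx y hy hlt)
  · exact heq
  · exact absurd h.symm (key y hy x hx hgt)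

/-- Darboux: a derivative without zeros on an interval has constant sign. -/
theorem strictMonoOn_or_strictAntiOn (hβ : 0 < β) (hT : IsPiecewiseDiffeo β a T) (i : Fin N) :
    StrictMonoOn T (piece a i) ∨ StrictAntiOn T (piece a i) := by
  have hconv : Convex ℝ (piece a i) := convex_Ioo _ _
  have hc := hT.continuousOn hβ i
  have hopen : interior (piece a i) = piece a i := isOpen_Ioo.interior_eq
  rcases hasDerivWithinAt_forall_lt_or_forall_gt_of_forall_ne hconv
    (fun x hx => (hT.differentiableAt hβ hx).hasDerivAt.hasDerivWithinAt)
    (fun x hx => hT.deriv_ne_zero hβ hx) with h | h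
  · exact Or.inr (strictAntiOn_of_deriv_neg hconv hc fun x hx => h x (hopen ▸ hx))
  · exact Or.inl (strictMonoOn_of_deriv_pos hconv hc fun x hx => h x (hopen ▸ hx))

theorem ordConnected_piece_inter_preimage (hβ : 0 < β) (hT : IsPiecewiseDiffeo β a T) (i : Fin N)
    {A : Set ℝ} (hA : A.OrdConnected) : (piece a i ∩ T ⁻¹' A).OrdConnected := by
  refine ⟨fun x hx y hy z hz => ?_⟩
  have hzp : z ∈ piece a i := (ordConnected_Ioo).out hx.1 hy.1 hz
  refine ⟨hzp, ?_⟩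
  rcases hT.strictMonoOn_or_strictAntiOn hβ i with h | h
  · exact hA.out hx.2 hy.2 ⟨h.monotoneOn hx.1 hzp hz.1, h.monotoneOn hzp hy.1 hz.2⟩
  · exact hA.out hy.2 hx.2 ⟨h.antitoneOn hzp hy.1 hz.2, h.antitoneOn hx.1 hzp hz.1⟩

theorem image_uIcc (hβ : 0 < β) (hT : IsPiecewiseDiffeo β a T) {i : Fin N} {u v : ℝ}
    (hu : u ∈ piece a i) (hv : v ∈ piece a i) : T '' uIcc u v = uIcc (T u) (T v) := by
  have hsub : uIcc u v ⊆ piece a i := (ordConnected_Ioo).uIcc_subset hu hv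
  have hc := (hT.continuousOn hβ i).mono hsub
  rcases hT.strictMonoOn_or_strictAntiOn hβ i with h | h
  · exact hc.image_uIcc_of_monotoneOn (h.mono hsub).monotoneOn
  · exact hc.image_uIcc_of_antitoneOn (h.mono hsub).antitoneOn

end IsPiecewiseDiffeo

end TransferBesov

namespace TransferBesov

/-! ### Derivatives of iterates and submultiplicativity of Θ^k. -/

section Growth

variable {β : ℝ} {N : ℕ} {a : Fin (N + 1) → ℝ} {T : ℝ → ℝ}

theorem hasDerivAt_iterate (hβ : 0 < β) (hT : IsPiecewiseDiffeo β a T) {k : ℕ} {x : ℝ}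
    (hx : ∀ j < k, ∃ i, T^[j] x ∈ piece a i) :
    HasDerivAt (T^[k]) (∏ j ∈ Finset.range k, deriv T (T^[j] x)) x := by
  induction k with
  | zero => simpa using hasDerivAt_id x
  | succ k ih =>
    obtain ⟨i, hi⟩ := hx k k.lt_succ_self
    rw [Finset.prod_range_succ, mul_comm, Function.iterate_succ']
    exact (hT.differentiableAt hβ hi).hasDerivAt.comp x (ih fun j hj => hx j (hj.trans k.lt_succ_self))

theorem deriv_iterate_of_mem_cylinder (hβ : 0 < β) (hT : IsPiecewiseDiffeo β a T) {k : ℕ}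
    {w : Fin k → Fin N} {x : ℝ} (hx : x ∈ cylinder a T w) :
    HasDerivAt (T^[k]) (∏ j ∈ Finset.range k, deriv T (T^[j] x)) x :=
  hasDerivAt_iterate hβ hT fun j hj => ⟨_, hx.2 ⟨j, hj⟩⟩

theorem exists_iterate_deriv_bounds (hβ : 0 < β) (hT : IsPiecewiseDiffeo β a T) :
    ∃ c M : ℝ, 0 < c ∧ 0 < M ∧ ∀ (k : ℕ) (w : Fin k → Fin N), ∀ x ∈ cylinder a T w,
      c ^ k ≤ |deriv (T^[k]) x| ∧ |deriv (T^[k]) x| ≤ M ^ k := by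
  obtain ⟨c, M, hc, hM, h⟩ := hT.exists_deriv_bounds hβ
  refine ⟨c, M, hc, hM, fun k w x hx => ?_⟩
  rw [(deriv_iterate_of_mem_cylinder hβ hT hx).deriv, Finset.abs_prod]
  have hj : ∀ j ∈ Finset.range k, c ≤ |deriv T (T^[j] x)| ∧ |deriv T (T^[j] x)| ≤ M :=
    fun j hj => h _ _ (hx.2 ⟨j, Finset.mem_range.1 hj⟩)
  constructor
  · simpa using Finset.prod_le_prod (fun _ _ => hc.le) fun j hj' => (hj j hj').1
  · simpa using Finset.prod_le_prod (fun _ _ => abs_nonneg _) fun j hj' => (hj j hj').2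

theorem deriv_iterate_ne_zero (hβ : 0 < β) (hT : IsPiecewiseDiffeo β a T) {k : ℕ}
    {w : Fin k → Fin N} {x : ℝ} (hx : x ∈ cylinder a T w) : deriv (T^[k]) x ≠ 0 := by
  obtain ⟨c, M, hc, -, h⟩ := exists_iterate_deriv_bounds hβ hT
  exact abs_pos.1 ((pow_pos hc k).trans_le (h k w x hx).1)

theorem inv_deriv_le_theta (hβ : 0 < β) (hT : IsPiecewiseDiffeo β a T) {k : ℕ}
    {w : Fin k → Fin N} {x : ℝ} (hx : x ∈ cylinder a T w) :
    1 / |deriv (T^[k]) x| ≤ theta a T w := by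
  obtain ⟨c, M, hc, -, h⟩ := exists_iterate_deriv_bounds hβ hT
  refine le_csSup ⟨1 / c ^ k, ?_⟩ (mem_image_of_mem _ hx)
  rintro _ ⟨y, hy, rfl⟩
  exact one_div_le_one_div_of_le (pow_pos hc k) (h k w y hy).1

theorem theta_nonneg {k : ℕ} (w : Fin k → Fin N) : 0 ≤ theta a T w := by
  refine Real.sSup_nonneg ?_
  rintro _ ⟨y, -, rfl⟩
  positivity

theorem iterate_mem_Icc (hT : IsPiecewiseDiffeo β a T) {k : ℕ} {w : Fin k → Fin N} {x : ℝ}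
    (hx : x ∈ cylinder a T w) : T^[k] x ∈ Icc (0 : ℝ) 1 := by
  rcases k with _ | k
  · exact hx.1
  · rw [Function.iterate_succ_apply']
    exact hT.mapsTo _ (hx.2 ⟨k, k.lt_succ_self⟩)

theorem mem_cylinder_append (hT : IsPiecewiseDiffeo β a T) {k l : ℕ} {u : Fin k → Fin N}
    {v : Fin l → Fin N} {x : ℝ} (hx : x ∈ cylinder a T (Fin.append u v)) :
    x ∈ cylinder a T u ∧ T^[k] x ∈ cylinder a T v := by
  have hu : x ∈ cylinder a T u :=
    ⟨hx.1, fun j => by simpa using hx.2 (Fin.castAdd l j)⟩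
  refine ⟨hu, iterate_mem_Icc hT hu, fun j => ?_⟩
  have := hx.2 (Fin.natAdd k j)
  rw [Fin.append_right] at this
  rwa [← Function.iterate_add_apply, add_comm]

/-- Chain rule along the orbit: the first k steps stay in the cylinder of u, the remaining l in that
of v. -/
theorem theta_append_le (hβ : 0 < β) (hT : IsPiecewiseDiffeo β a T) {k l : ℕ} {u : Fin k → Fin N}
    {v : Fin l → Fin N} (hne : (cylinder a T (Fin.append u v)).Nonempty) :
    theta a T (Fin.append u v) ≤ theta a T u * theta a T v := by
  refine csSup_le (hne.image _) ?_
  rintro _ ⟨x, hx, rfl⟩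
  obtain ⟨hu, hv⟩ := mem_cylinder_append hT hx
  have hd : deriv (T^[k + l]) x = deriv (T^[k]) x * deriv (T^[l]) (T^[k] x) := by
    rw [(deriv_iterate_of_mem_cylinder hβ hT hx).deriv,
      (deriv_iterate_of_mem_cylinder hβ hT hu).deriv,
      (deriv_iterate_of_mem_cylinder hβ hT hv).deriv, Finset.prod_range_add]
    congr 1
    refine Finset.prod_congr rfl fun j _ => ?_
    rw [← Function.iterate_add_apply, add_comm]
  simp only
  rw [hd, abs_mul, ← one_div_mul_one_div]
  exact mul_le_mul (inv_deriv_le_theta hβ hT hu) (inv_deriv_le_theta hβ hT hv) (by positivity)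
    (theta_nonneg u)

theorem Theta_nonneg (γ : ℝ) (k : ℕ) : 0 ≤ Theta a T γ k := by
  refine Finset.sum_nonneg fun w _ => ?_
  split_ifs
  · exact Real.rpow_nonneg (theta_nonneg w) _
  · exact le_rfl

theorem Theta_add_le (hβ : 0 < β) (hT : IsPiecewiseDiffeo β a T) {γ : ℝ} (hγ : 0 ≤ γ) (k l : ℕ) :
    Theta a T γ (k + l) ≤ Theta a T γ k * Theta a T γ l := by
  classical
  have key : ∀ (u : Fin k → Fin N) (v : Fin l → Fin N),
      (if (cylinder a T (Fin.append u v)).Nonempty then theta a T (Fin.append u v) ^ γ else 0) ≤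
        (if (cylinder a T u).Nonempty then theta a T u ^ γ else 0) *
          if (cylinder a T v).Nonempty then theta a T v ^ γ else 0 := by
    intro u v
    by_cases hne : (cylinder a T (Fin.append u v)).Nonempty
    · obtain ⟨x, hx⟩ := id hne
      obtain ⟨hu, hv⟩ := mem_cylinder_append hT hx
      rw [if_pos hne, if_pos ⟨x, hu⟩, if_pos ⟨_, hv⟩,
        ← Real.mul_rpow (theta_nonneg u) (theta_nonneg v)]
      exact Real.rpow_le_rpow (theta_nonneg _) (theta_append_le hβ hT hne) hγ
    · rw [if_neg hne]
      have h0 : ∀ {m : ℕ} (w : Fin m → Fin N),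
          0 ≤ if (cylinder a T w).Nonempty then theta a T w ^ γ else 0 := fun w => by
        split_ifs
        · exact Real.rpow_nonneg (theta_nonneg w) _
        · exact le_rfl
      exact mul_nonneg (h0 u) (h0 v)
  unfold Theta
  rw [Finset.sum_mul_sum, ← Fintype.sum_prod_type', ← (Fin.appendEquiv k l).sum_comp]
  exact Finset.sum_le_sum fun p _ => key p.1 p.2

end Growth

/-- A submultiplicative sequence bounded below by a geometric sequence has a growth rate, which is
positive. -/
theorem tendsto_rpow_inv_of_submultiplicative {u : ℕ → ℝ} {c : ℝ} (hc : 0 < c)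
    (hlow : ∀ k, c ^ k ≤ u k) (hsub : ∀ k l, u (k + l) ≤ u k * u l) :
    ∃ r, 0 < r ∧ Tendsto (fun k : ℕ => u k ^ (1 / (k : ℝ))) atTop (𝓝 r) := by
  have hpos : ∀ k, 0 < u k := fun k => (pow_pos hc k).trans_le (hlow k)
  have hs : Subadditive fun k => Real.log (u k) := fun k l => by
    rw [← Real.log_mul (hpos k).ne' (hpos l).ne']
    exact Real.log_le_log (hpos _) (hsub k l)
  have hb : BddBelow (range fun n => Real.log (u n) / n) := by
    -- The minimum with 0 covers n = 0, where the quotient is 0 by convention.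
    refine ⟨min (Real.log c) 0, ?_⟩
    rintro _ ⟨n, rfl⟩
    rcases Nat.eq_zero_or_pos n with rfl | hn
    · simp
    · refine (min_le_left _ _).trans ?_
      rw [le_div_iff₀ (by exact_mod_cast hn), mul_comm, ← Real.log_pow]
      exact Real.log_le_log (pow_pos hc n) (hlow n)
  refine ⟨Real.exp hs.lim, Real.exp_pos _, ?_⟩
  refine ((Real.continuous_exp.tendsto _).comp (hs.tendsto_lim hb)).congr fun k => ?_
  rw [Function.comp_apply, Real.rpow_def_of_pos (hpos k)]
  congr 1
  ring

/-! ### Consequences of invariance: almost every orbit stays in the pieces; existence of Θ^∞. -/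

section Koopman

variable {β : ℝ} {N : ℕ} {a : Fin (N + 1) → ℝ} {T : ℝ → ℝ}

/-- Invariance applied to A = I gives the union of the pieces full measure. -/
theorem ae_mem_pieces (hT : IsPiecewiseDiffeo β a T) (hinv : PreservesLebesgue a T) :
    ∀ᵐ x ∂mI, x ∈ ⋃ i, piece a i := by
  have h1 := hinv (Icc 0 1) measurableSet_Icc subset_rfl
  have hsub : (⋃ i, piece a i) ⊆ T ⁻¹' Icc 0 1 := iUnion_subset fun i x hx => hT.mapsTo i hx
  rw [inter_eq_left.2 hsub] at h1
  have hm : MeasurableSet (⋃ i, piece a i) := .iUnion fun i => measurableSet_Ioo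
  have h2 : (Icc (0 : ℝ) 1 : Set ℝ) =ᵐ[volume] ⋃ i, piece a i := by
    symm
    refine ae_eq_of_subset_of_measure_ge (iUnion_subset fun i => hT.piece_subset i) h1.ge
      hm.nullMeasurableSet (by simp)
  rw [ae_restrict_iff' measurableSet_Icc]
  filter_upwards [h2.mem_iff] with x hx using hx.1

/-- `T` agrees almost everywhere with a measure preserving map of the line. -/
theorem exists_measurePreserving (hβ : 0 < β) (hT : IsPiecewiseDiffeo β a T)
    (hinv : PreservesLebesgue a T) :
    ∃ F : ℝ → ℝ, MeasurePreserving F mI mI ∧ EqOn F T (⋃ i, piece a i) := by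
  classical
  have hm : MeasurableSet (⋃ i, piece a i) := .iUnion fun i => measurableSet_Ioo
  have hc : ContinuousOn T (⋃ i, piece a i) := fun x hx => by
    obtain ⟨i, hi⟩ := mem_iUnion.1 hx
    exact (hT.differentiableAt hβ hi).continuousAt.continuousWithinAt
  refine ⟨(⋃ i, piece a i).piecewise T 0, ⟨hc.measurable_piecewise continuousOn_const hm, ?_⟩,
    fun x hx => piecewise_eq_of_mem _ _ _ hx⟩
  ext A hA
  have hF : Measurable ((⋃ i, piece a i).piecewise T 0) :=
    hc.measurable_piecewise continuousOn_const hm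
  rw [Measure.map_apply hF hA, Measure.restrict_apply hA,
    ← hinv _ (hA.inter measurableSet_Icc) inter_subset_right,
    ← measure_inter_add_sdiff₀ (μ := mI) _ hm.nullMeasurableSet]
  have hz : mI ((⋃ i, piece a i).piecewise T 0 ⁻¹' A \ ⋃ i, piece a i) = 0 :=
    measure_mono_null (fun x hx => hx.2) (ae_mem_pieces hT hinv)
  rw [hz, add_zero, Measure.restrict_apply ((hF hA).inter hm)]
  congr 1
  ext x
  constructor
  · rintro ⟨⟨hx, hxp⟩, hxI⟩
    obtain ⟨i, hi⟩ := mem_iUnion.1 hxp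
    refine ⟨hxp, ?_, hT.mapsTo i hi⟩
    rwa [mem_preimage, piecewise_eq_of_mem _ _ _ hxp] at hx
  · rintro ⟨hxp, hx, -⟩
    obtain ⟨i, hi⟩ := mem_iUnion.1 hxp
    refine ⟨⟨?_, hxp⟩, hT.piece_subset i hi⟩
    rwa [mem_preimage, piecewise_eq_of_mem _ _ _ hxp]

/-- Almost every orbit never leaves the pieces. One nonempty cylinder of each length is what keeps
Θ^k above a geometric sequence. -/
theorem exists_cylinder_nonempty (hβ : 0 < β) (hT : IsPiecewiseDiffeo β a T)
    (hinv : PreservesLebesgue a T) (k : ℕ) : ∃ w : Fin k → Fin N, (cylinder a T w).Nonempty := by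
  obtain ⟨F, hF, hFT⟩ := exists_measurePreserving hβ hT hinv
  have hp := ae_mem_pieces hT hinv
  have h1 : ∀ᵐ x ∂mI, ∀ j, F^[j] x ∈ ⋃ i, piece a i :=
    ae_all_iff.2 fun j => (hF.iterate j).quasiMeasurePreserving.ae hp
  have hne : (ae mI).NeBot := by
    rw [ae_neBot, Ne, Measure.restrict_eq_zero]
    simp
  obtain ⟨x, hx, hxI⟩ := (h1.and (ae_restrict_mem measurableSet_Icc)).exists
  have hit : ∀ j, T^[j] x = F^[j] x := fun j => by
    induction j with
    | zero => rfl
    | succ j ih => rw [Function.iterate_succ_apply', Function.iterate_succ_apply', ih, hFT (hx j)]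
  choose w hw using fun j => mem_iUnion.1 (hx j)
  exact ⟨fun j => w j, x, hxI, fun j => by rw [hit]; exact hw j⟩

theorem exists_tendsto_Theta (hβ : 0 < β) (hT : IsPiecewiseDiffeo β a T)
    (hinv : PreservesLebesgue a T) {γ : ℝ} (hγ : 0 ≤ γ) :
    ∃ r, 0 < r ∧ Tendsto (fun k : ℕ => Theta a T γ k ^ (1 / (k : ℝ))) atTop (𝓝 r) := by
  classical
  obtain ⟨c, M, hc, hM, h⟩ := exists_iterate_deriv_bounds hβ hT
  refine tendsto_rpow_inv_of_submultiplicative (c := (1 / M) ^ γ) (by positivity) (fun k => ?_)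
    (Theta_add_le hβ hT hγ)
  obtain ⟨w, x, hx⟩ := exists_cylinder_nonempty hβ hT hinv k
  calc ((1 / M) ^ γ) ^ k = ((1 / M) ^ k) ^ γ := by
        rw [← Real.rpow_natCast, ← Real.rpow_natCast, ← Real.rpow_mul (by positivity),
          ← Real.rpow_mul (by positivity), mul_comm]
    _ ≤ theta a T w ^ γ := by
        refine Real.rpow_le_rpow (by positivity) (le_trans ?_ (inv_deriv_le_theta hβ hT hx)) hγ
        rw [one_div_pow]
        exact one_div_le_one_div_of_le (abs_pos.2 (deriv_iterate_ne_zero hβ hT hx)) (h k w x hx).2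
    _ = if (cylinder a T w).Nonempty then theta a T w ^ γ else 0 := by rw [if_pos ⟨x, hx⟩]
    _ ≤ Theta a T γ k := by
        refine Finset.single_le_sum (f := fun w : Fin k → Fin N =>
          if (cylinder a T w).Nonempty then theta a T w ^ γ else 0) (fun v _ => ?_)
          (Finset.mem_univ w)
        split_ifs
        · exact Real.rpow_nonneg (theta_nonneg v) _
        · exact le_rfl

end Koopman

end TransferBesov

namespace TransferBesov

/-! ### The Koopman operator on L¹(I) and on indicators of intervals. -/

variable {β : ℝ} {N : ℕ} {a : Fin (N + 1) → ℝ} {T F : ℝ → ℝ}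

/-- The Koopman operator `f ↦ f ∘ F` of a measure preserving map. -/
noncomputable def koopman (hF : MeasurePreserving F mI mI) : L1I →ₗᵢ[ℂ] L1I :=
  Lp.compMeasurePreservingₗᵢ ℂ F hF

theorem coeFn_koopman (hF : MeasurePreserving F mI mI) (f : L1I) :
    koopman hF f =ᵐ[mI] f ∘ F :=
  Lp.coeFn_compMeasurePreserving f hF

theorem coeFn_indL1 (Q : Set ℝ) (hQ : Q.OrdConnected) :
    indL1 Q hQ =ᵐ[mI] Q.indicator fun _ => 1 :=
  indicatorConstLp_coeFn

theorem indL1_congr {Q Q' : Set ℝ} (h : Q = Q') (hQ : Q.OrdConnected) (hQ' : Q'.OrdConnected) :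
    indL1 Q hQ = indL1 Q' hQ' := by
  subst h; rfl

/-! ### Transfer images -/

theorem integrable_mul_bounded (f : L1I) {g : ℝ → ℂ} (hg : Measurable g)
    (hb : ∃ M : ℝ, ∀ x, ‖g x‖ ≤ M) : Integrable (fun x => f x * g x) mI := by
  obtain ⟨M, hM⟩ := hb
  exact (L1.integrable_coeFn f).mul_bdd hg.aestronglyMeasurable (ae_of_all _ hM)

theorem IsTransferImage.unique {f h h' : L1I} (H : IsTransferImage T f h)
    (H' : IsTransferImage T f h') : h = h' := by
  refine Lp.ext ((L1.integrable_coeFn h).ae_eq_of_forall_setIntegral_eq _ _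
    (L1.integrable_coeFn h') fun A hA _ => ?_)
  have hg : Measurable (A.indicator fun _ => (1 : ℂ)) := measurable_const.indicator hA
  have hb : ∃ M : ℝ, ∀ x, ‖A.indicator (fun _ => (1 : ℂ)) x‖ ≤ M :=
    ⟨1, fun x => by by_cases hx : x ∈ A <;> simp [hx]⟩
  have := (H _ hg hb).trans (H' _ hg hb).symm
  have e : ∀ h : L1I, (fun x => h x * A.indicator (fun _ => (1 : ℂ)) x) = A.indicator h := by
    intro h
    ext x
    by_cases hx : x ∈ A <;> simp [hx]
  rwa [e, e, integral_indicator hA, integral_indicator hA] at this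

theorem isTransferImage_koopman (hT : IsPiecewiseDiffeo β a T) (hinv : PreservesLebesgue a T)
    (hF : MeasurePreserving F mI mI) (hFT : EqOn F T (⋃ i, piece a i)) (f : L1I) :
    IsTransferImage T (koopman hF f) f := by
  intro g hg hb
  have hm := (integrable_mul_bounded f hg hb).aestronglyMeasurable
  have hmap := integral_map (μ := mI) hF.measurable.aemeasurable (f := fun x => f x * g x)
    (by rwa [hF.map_eq])
  rw [hF.map_eq] at hmap
  rw [hmap]
  refine integral_congr_ae ?_
  filter_upwards [coeFn_koopman hF f, ae_mem_pieces hT hinv] with x hx hxp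
  rw [hx, Function.comp_apply, hFT hxp]

/-! ### Indicators of cylinders -/

/-- The induction step for iterates: composing with T once more puts a letter in front of the word.
-/
theorem preimage_cylinder_cons (hT : IsPiecewiseDiffeo β a T) {k : ℕ} (i : Fin N)
    (w : Fin k → Fin N) (Q : Set ℝ) :
    cylinder a T (Fin.cons i w : Fin (k + 1) → Fin N) ∩ T^[k + 1] ⁻¹' Q =
      piece a i ∩ T ⁻¹' (cylinder a T w ∩ T^[k] ⁻¹' Q) := by
  ext x
  constructor
  · rintro ⟨⟨hx, hw⟩, hQ⟩
    have h0 : x ∈ piece a i := hw 0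
    exact ⟨h0, ⟨hT.mapsTo i h0, fun j => by simpa using hw j.succ⟩, hQ⟩
  · rintro ⟨h0, ⟨-, hw⟩, hQ⟩
    refine ⟨⟨hT.piece_subset i h0, fun j => ?_⟩, hQ⟩
    refine Fin.cases ?_ (fun j => ?_) j
    · simpa using h0
    · simpa using hw j

theorem ordConnected_cylinder_inter (hβ : 0 < β) (hT : IsPiecewiseDiffeo β a T) {Q : Set ℝ}
    (hQ : Q.OrdConnected) {k : ℕ} (w : Fin k → Fin N) :
    (cylinder a T w ∩ T^[k] ⁻¹' Q).OrdConnected := by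
  induction k with
  | zero =>
    have : cylinder a T w = Icc 0 1 := by
      ext x
      exact ⟨fun h => h.1, fun h => ⟨h, fun j => j.elim0⟩⟩
    rw [this]
    exact ordConnected_Icc.inter hQ
  | succ k ih =>
    rw [← Fin.cons_self_tail w, preimage_cylinder_cons hT]
    exact hT.ordConnected_piece_inter_preimage hβ _ (ih _)

theorem koopman_indL1 (hβ : 0 < β) (hT : IsPiecewiseDiffeo β a T) (hinv : PreservesLebesgue a T)
    (hF : MeasurePreserving F mI mI) (hFT : EqOn F T (⋃ i, piece a i)) (A : Set ℝ)
    (hA : A.OrdConnected) :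
    koopman hF (indL1 A hA) =
      ∑ i, indL1 (piece a i ∩ T ⁻¹' A) (hT.ordConnected_piece_inter_preimage hβ i hA) := by
  refine Lp.ext ?_
  have h1 := hF.quasiMeasurePreserving.ae_eq_comp (coeFn_indL1 A hA)
  have h2 : ∀ᵐ x ∂mI, ∀ i : Fin N,
      indL1 (piece a i ∩ T ⁻¹' A) (hT.ordConnected_piece_inter_preimage hβ i hA) x
        = (piece a i ∩ T ⁻¹' A).indicator (fun _ => 1) x :=
    ae_all_iff.2 fun i => coeFn_indL1 _ _
  filter_upwards [coeFn_koopman hF (indL1 A hA), h1, h2, ae_mem_pieces hT hinv,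
    Lp.coeFn_fun_finsetSum Finset.univ fun i =>
      indL1 (piece a i ∩ T ⁻¹' A) (hT.ordConnected_piece_inter_preimage hβ i hA)]
    with x hx1 hx2 hx3 hx4 hx5
  rw [hx1, hx2, hx5]
  obtain ⟨i, hi⟩ := mem_iUnion.1 hx4
  simp only [hx3]
  rw [Finset.sum_eq_single i]
  · rw [Function.comp_apply, hFT hx4]
    by_cases h : T x ∈ A
    · rw [indicator_of_mem h, indicator_of_mem (show x ∈ piece a i ∩ T ⁻¹' A from ⟨hi, h⟩)]
    · rw [indicator_of_notMem h, indicator_of_notMem fun h' => h h'.2]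
  · intro j _ hj
    exact indicator_of_notMem (fun h => hj (hT.eq_of_mem_piece h.1 hi)) _
  · exact fun h => absurd (Finset.mem_univ i) h

theorem koopman_iterate_indL1 (hβ : 0 < β) (hT : IsPiecewiseDiffeo β a T)
    (hinv : PreservesLebesgue a T) (hF : MeasurePreserving F mI mI)
    (hFT : EqOn F T (⋃ i, piece a i)) {Q : Set ℝ} (hQ : Q.OrdConnected) (hQI : Q ⊆ Icc 0 1)
    (k : ℕ) :
    (koopman hF)^[k] (indL1 Q hQ) = ∑ w : Fin k → Fin N,
      indL1 (cylinder a T w ∩ T^[k] ⁻¹' Q) (ordConnected_cylinder_inter hβ hT hQ w) := by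
  induction k with
  | zero =>
    rw [Fintype.sum_unique]
    refine indL1_congr ?_ _ _
    ext x
    exact ⟨fun h => ⟨⟨hQI h, fun j => j.elim0⟩, h⟩, fun h => h.2⟩
  | succ k ih =>
    rw [Function.iterate_succ_apply', ih, map_sum,
      ← (Fin.consEquiv fun _ : Fin (k + 1) => Fin N).sum_comp, Fintype.sum_prod_type_right]
    refine Finset.sum_congr rfl fun w _ => ?_
    rw [koopman_indL1 hβ hT hinv hF hFT]
    exact Finset.sum_congr rfl fun i _ =>
      indL1_congr (preimage_cylinder_cons hT i w Q).symm _ _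

theorem ordConnected_cylinder (hβ : 0 < β) (hT : IsPiecewiseDiffeo β a T) {k : ℕ}
    (w : Fin k → Fin N) : (cylinder a T w).OrdConnected := by
  simpa using ordConnected_cylinder_inter hβ hT ordConnected_univ w

/-- Mean value theorem on the cylinder, which is an interval: two points of the set are at most θ_w
times as far apart as their images in Q. The measure is then bounded by the diameter. -/
theorem volume_real_cylinder_inter_le (hβ : 0 < β) (hT : IsPiecewiseDiffeo β a T) {Q : Set ℝ}
    (hQ : Q.OrdConnected) (hQI : Q ⊆ Icc 0 1) {k : ℕ} (w : Fin k → Fin N) :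
    volume.real (cylinder a T w ∩ T^[k] ⁻¹' Q) ≤ theta a T w * volume.real Q := by
  have hQfin : volume Q ≠ ∞ := measure_ne_top_of_subset hQI (by simp)
  have hlen : ∀ p ∈ Q, ∀ q ∈ Q, |p - q| ≤ volume.real Q := by
    intro p hp q hq
    have : volume.real (uIcc q p) ≤ volume.real Q :=
      measureReal_mono (hQ.uIcc_subset hq hp) hQfin
    rwa [Real.volume_real_interval] at this
  have key : ∀ x ∈ cylinder a T w ∩ T^[k] ⁻¹' Q, ∀ y ∈ cylinder a T w ∩ T^[k] ⁻¹' Q, x < y →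
      y - x ≤ theta a T w * volume.real Q := by
    intro x hx y hy hxy
    have hsub : Icc x y ⊆ cylinder a T w := (ordConnected_cylinder hβ hT w).out hx.1 hy.1
    have hd : ∀ z ∈ Icc x y, HasDerivAt (T^[k]) (deriv (T^[k]) z) z := fun z hz =>
      (deriv_iterate_of_mem_cylinder hβ hT (hsub hz)).differentiableAt.hasDerivAt
    obtain ⟨z, hz, hz'⟩ := exists_hasDerivAt_eq_slope (T^[k]) (deriv (T^[k])) hxy
      (fun z hz => (hd z hz).continuousAt.continuousWithinAt)
      fun z hz => hd z (Ioo_subset_Icc_self hz)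
    have hzc := hsub (Ioo_subset_Icc_self hz)
    have h0 := abs_pos.2 (deriv_iterate_ne_zero hβ hT hzc)
    have hyx : 0 < y - x := sub_pos.2 hxy
    calc y - x = 1 / |deriv (T^[k]) z| * |T^[k] y - T^[k] x| := by
          rw [one_div, eq_inv_mul_iff_mul_eq₀ h0.ne', hz', abs_div, abs_of_pos hyx]
          field_simp
      _ ≤ theta a T w * volume.real Q :=
          mul_le_mul (inv_deriv_le_theta hβ hT hzc) (hlen _ hy.2 _ hx.2) (abs_nonneg _)
            (theta_nonneg w)
  have hr : 0 ≤ theta a T w * volume.real Q := mul_nonneg (theta_nonneg w) measureReal_nonneg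
  refine ENNReal.toReal_le_of_le_ofReal hr ((Real.volume_le_diam _).trans ?_)
  refine Metric.ediam_le fun x hx y hy => ?_
  rw [edist_dist, Real.dist_eq]
  refine ENNReal.ofReal_le_ofReal ?_
  rcases lt_trichotomy x y with h | h | h
  · rw [abs_sub_comm, abs_of_pos (sub_pos.2 h)]
    exact key x hx y hy h
  · simpa [h] using hr
  · rw [abs_of_pos (sub_pos.2 h)]
    exact key y hy x hx h

theorem sum_volume_real_rpow_le (hβ : 0 < β) (hT : IsPiecewiseDiffeo β a T) {Q : Set ℝ}
    (hQ : Q.OrdConnected) (hQI : Q ⊆ Icc 0 1) {γ : ℝ} (hγ : 0 < γ) (k : ℕ) :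
    ∑ w : Fin k → Fin N, volume.real (cylinder a T w ∩ T^[k] ⁻¹' Q) ^ γ ≤
      Theta a T γ k * volume.real Q ^ γ := by
  classical
  rw [Theta, Finset.sum_mul]
  refine Finset.sum_le_sum fun w _ => ?_
  split_ifs with h
  · rw [← Real.mul_rpow (theta_nonneg w) measureReal_nonneg]
    exact Real.rpow_le_rpow measureReal_nonneg (volume_real_cylinder_inter_le hβ hT hQ hQI w) hγ.le
  · rw [not_nonempty_iff_eq_empty.1 h, empty_inter, measureReal_empty, Real.zero_rpow hγ.ne',
      zero_mul]

end TransferBesov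

namespace TransferBesov

/-! ### Lifting convergent series from L¹ to B, with control of orbits. -/

section Lift

variable {B E : Type*} [NormedAddCommGroup B] [NormedSpace ℂ B]
  [NormedAddCommGroup E] [NormedSpace ℂ E] {ι : B →L[ℂ] E}

/-- The lifted series converges absolutely in B, and continuity of `ι` identifies the image of its
sum. -/
theorem exists_lift_of_tendsto [CompleteSpace B] {ψ : ℕ → E} {φ : E} {r : ℕ → ℝ}
    (hr : Summable r) (h : ∀ n, ∃ b, ι b = ψ n ∧ ‖b‖ ≤ r n)
    (hφ : Tendsto (fun m => ∑ n ∈ Finset.range m, ψ n) atTop (𝓝 φ)) :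
    ∃ b, ι b = φ ∧ ‖b‖ ≤ ∑' n, r n := by
  choose b hb hbr using h
  have hs : Summable b := .of_norm_bounded hr hbr
  refine ⟨∑' n, b n, ?_, tsum_of_norm_bounded hr.hasSum hbr⟩
  refine tendsto_nhds_unique ?_ hφ
  have := (ι.continuous.tendsto _).comp hs.hasSum.tendsto_sum_nat
  refine this.congr fun m => ?_
  simp [map_sum, hb]

theorem exists_lift_sum {κ : Type*} (S : Finset κ) {ψ : κ → E} {r : κ → ℝ}
    (h : ∀ n, ∃ b, ι b = ψ n ∧ ‖b‖ ≤ r n) :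
    ∃ b, ι b = ∑ n ∈ S, ψ n ∧ ‖b‖ ≤ ∑ n ∈ S, r n := by
  choose b hb hbr using h
  exact ⟨∑ n ∈ S, b n, by simp [map_sum, hb], norm_sum_le_of_le _ fun n _ => hbr n⟩

/-- The orbit of `f` under `U` lies in the image of `ι`, with norms at most `R * θ k`. -/
def HasBoundedOrbit (ι : B →L[ℂ] E) (U : E →L[ℂ] E) (θ : ℕ → ℝ) (f : E) (R : ℝ) : Prop :=
  ∀ k, ∃ b, ι b = (U ^ k) f ∧ ‖b‖ ≤ R * θ k

namespace HasBoundedOrbit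

variable {U : E →L[ℂ] E} {θ : ℕ → ℝ} {f g : E} {R S : ℝ}

theorem mono (hf : HasBoundedOrbit ι U θ f R) (hθ : ∀ k, 0 ≤ θ k) (h : R ≤ S) :
    HasBoundedOrbit ι U θ f S := fun k => by
  obtain ⟨b, hb, hbr⟩ := hf k
  exact ⟨b, hb, hbr.trans (mul_le_mul_of_nonneg_right h (hθ k))⟩

theorem add (hf : HasBoundedOrbit ι U θ f R) (hg : HasBoundedOrbit ι U θ g S) :
    HasBoundedOrbit ι U θ (f + g) (R + S) := fun k => by
  obtain ⟨b, hb, hbr⟩ := hf k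
  obtain ⟨c, hc, hcr⟩ := hg k
  exact ⟨b + c, by rw [map_add, map_add, hb, hc],
    (norm_add_le_of_le hbr hcr).trans_eq (add_mul _ _ _).symm⟩

theorem smul (hf : HasBoundedOrbit ι U θ f R) (c : ℂ) :
    HasBoundedOrbit ι U θ (c • f) (‖c‖ * R) := fun k => by
  obtain ⟨b, hb, hbr⟩ := hf k
  refine ⟨c • b, by rw [map_smul, map_smul, hb], ?_⟩
  rw [norm_smul, mul_assoc]
  exact mul_le_mul_of_nonneg_left hbr (norm_nonneg c)

theorem sub (hf : HasBoundedOrbit ι U θ f R) (hg : HasBoundedOrbit ι U θ g S) :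
    HasBoundedOrbit ι U θ (f - g) (R + S) := by
  simpa [sub_eq_add_neg] using hf.add (hg.smul (-1))

theorem of_tendsto [CompleteSpace B] {f : ℕ → E} {φ : E} {R : ℕ → ℝ}
    (hf : ∀ n, HasBoundedOrbit ι U θ (f n) (R n)) (hR : Summable R)
    (hφ : Tendsto (fun m => ∑ n ∈ Finset.range m, f n) atTop (𝓝 φ)) :
    HasBoundedOrbit ι U θ φ (∑' n, R n) := fun k => by
  rw [← tsum_mul_right]
  refine exists_lift_of_tendsto (hR.mul_right _) (fun n => hf n k) ?_
  refine (((U ^ k).continuous.tendsto φ).comp hφ).congr fun m => ?_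
  exact map_sum (U ^ k) _ _

end HasBoundedOrbit

end Lift

/-! ### Hölder functions on an interval have bounded orbits. -/

section Hoelder

/-- Left-endpoint approximation of `h` on `[u, u + l)` by a step function with `2 ^ n` steps. -/
noncomputable def stepApprox (h : ℝ → ℂ) : ℕ → ℝ → ℝ → L1I
  | 0, u, l => h u • indL1 (Ico u (u + l)) ordConnected_Ico
  | n + 1, u, l => stepApprox h n u (l / 2) + stepApprox h n (u + l / 2) (l / 2)

theorem Ico_indicator_split {M : Type*} [AddZeroClass M] (g : ℝ → M) {u l : ℝ} (hl : 0 < l)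
    (x : ℝ) :
    (Ico u (u + l)).indicator g x = (Ico u (u + l / 2)).indicator g x +
      (Ico (u + l / 2) (u + l / 2 + l / 2)).indicator g x := by
  have e : u + l / 2 + l / 2 = u + l := by ring
  rw [e, ← Ico_union_Ico_eq_Ico (show u ≤ u + l / 2 by linarith) (show u + l / 2 ≤ u + l by linarith),
    indicator_union_of_disjoint Ico_disjoint_Ico_same]

theorem indL1_Ico_split (u : ℝ) {l : ℝ} (hl : 0 < l) :
    indL1 (Ico u (u + l)) ordConnected_Ico = indL1 (Ico u (u + l / 2)) ordConnected_Ico +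
      indL1 (Ico (u + l / 2) (u + l / 2 + l / 2)) ordConnected_Ico := by
  refine Lp.ext ?_
  filter_upwards [coeFn_indL1 (Ico u (u + l)) ordConnected_Ico,
    coeFn_indL1 (Ico u (u + l / 2)) ordConnected_Ico,
    coeFn_indL1 (Ico (u + l / 2) (u + l / 2 + l / 2)) ordConnected_Ico,
    Lp.coeFn_add (indL1 (Ico u (u + l / 2)) ordConnected_Ico)
      (indL1 (Ico (u + l / 2) (u + l / 2 + l / 2)) ordConnected_Ico)] with x h1 h2 h3 h4
  rw [h4, Pi.add_apply, h1, h2, h3, Ico_indicator_split _ hl]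

variable {h : ℝ → ℂ} {D : Set ℝ} {H α : ℝ}

theorem Ico_half_subset {u l : ℝ} (hl : 0 < l) (hD : Ico u (u + l) ⊆ D) :
    Ico u (u + l / 2) ⊆ D ∧ Ico (u + l / 2) (u + l / 2 + l / 2) ⊆ D := by
  constructor
  · exact (Ico_subset_Ico_right (by linarith)).trans hD
  · exact (Ico_subset_Ico (by linarith) (by linarith)).trans hD

theorem stepApprox_ae_bound (hα : 0 < α) (hH : 0 ≤ H)
    (hh : ∀ x ∈ D, ∀ y ∈ D, ‖h x - h y‖ ≤ H * |x - y| ^ α) (n : ℕ) :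
    ∀ {u l : ℝ}, 0 < l → Ico u (u + l) ⊆ D → ∀ᵐ x ∂mI,
      ‖stepApprox h n u l x - (Ico u (u + l)).indicator h x‖ ≤
        (Ico u (u + l)).indicator (fun _ => H * (l / 2 ^ n) ^ α) x := by
  induction n with
  | zero =>
    intro u l hl hD
    filter_upwards [coeFn_indL1 (Ico u (u + l)) ordConnected_Ico,
      Lp.coeFn_smul (h u) (indL1 (Ico u (u + l)) ordConnected_Ico)] with x h1 h2
    rw [stepApprox, h2, Pi.smul_apply, h1]
    by_cases hx : x ∈ Ico u (u + l)
    · simp only [indicator_of_mem hx, pow_zero, div_one, smul_eq_mul, mul_one]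
      refine (hh u (hD ⟨le_rfl, by linarith⟩) x (hD hx)).trans ?_
      gcongr
      rw [abs_sub_comm, abs_of_nonneg (by linarith [hx.1])]
      linarith [hx.2]
    · simp [indicator_of_notMem hx]
  | succ n ih =>
    intro u l hl hD
    obtain ⟨hD1, hD2⟩ := Ico_half_subset hl hD
    filter_upwards [ih (half_pos hl) hD1, ih (half_pos hl) hD2,
      Lp.coeFn_add (stepApprox h n u (l / 2)) (stepApprox h n (u + l / 2) (l / 2))] with x h1 h2 h3
    rw [stepApprox, h3, Pi.add_apply, Ico_indicator_split h hl, Ico_indicator_split _ hl,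
      add_sub_add_comm]
    have e : l / 2 ^ (n + 1) = l / 2 / 2 ^ n := by rw [pow_succ]; field_simp
    rw [e]
    exact norm_add_le_of_le h1 h2

theorem tendsto_stepApprox (hα : 0 < α) (hH : 0 ≤ H)
    (hh : ∀ x ∈ D, ∀ y ∈ D, ‖h x - h y‖ ≤ H * |x - y| ^ α) {u l : ℝ} (hl : 0 < l)
    (hD : Ico u (u + l) ⊆ D) {φ : L1I} (hφ : φ =ᵐ[mI] (Ico u (u + l)).indicator h) :
    Tendsto (fun n => stepApprox h n u l) atTop (𝓝 φ) := by
  rw [tendsto_iff_norm_sub_tendsto_zero]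
  have hb : ∀ n, ‖stepApprox h n u l - φ‖ ≤
      (measureUnivNNReal mI : ℝ) ^ (1 : ℝ≥0∞).toReal⁻¹ * (H * (l / 2 ^ n) ^ α) := fun n => by
    refine Lp.norm_le_of_ae_bound (by positivity) ?_
    filter_upwards [stepApprox_ae_bound hα hH hh n hl hD, hφ,
      Lp.coeFn_sub (stepApprox h n u l) φ] with x h1 h2 h3
    rw [h3, Pi.sub_apply, h2]
    exact h1.trans (indicator_le_self' (fun _ _ => by positivity) x)
  refine squeeze_zero (fun _ => norm_nonneg _) hb ?_
  have h0 : Tendsto (fun n : ℕ => l / 2 ^ n) atTop (𝓝 0) := by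
    simpa [div_eq_mul_inv] using
      (tendsto_pow_atTop_nhds_zero_of_lt_one (by norm_num) (by norm_num : (2⁻¹ : ℝ) < 1)).const_mul l
  have h1 := (h0.rpow_const (p := α) (Or.inr hα.le)).const_mul H
  rw [Real.zero_rpow hα.ne', mul_zero] at h1
  simpa using h1.const_mul ((measureUnivNNReal mI : ℝ) ^ (1 : ℝ≥0∞).toReal⁻¹)

variable {B : Type*} [NormedAddCommGroup B] [NormedSpace ℂ B] {ι : B →L[ℂ] L1I}
  {U : L1I →L[ℂ] L1I} {θ : ℕ → ℝ} {s C : ℝ}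

theorem hasBoundedOrbit_Ico
    (hInd : ∀ (J : Set ℝ) (hJ : J.OrdConnected), J ⊆ Icc 0 1 →
      HasBoundedOrbit ι U θ (indL1 J hJ) (C * volume.real J ^ (1 - s)))
    {u l : ℝ} (hl : 0 < l) (hI : Ico u (u + l) ⊆ Icc 0 1) :
    HasBoundedOrbit ι U θ (indL1 (Ico u (u + l)) ordConnected_Ico) (C * l ^ (1 - s)) := by
  have := hInd _ (ordConnected_Ico (a := u) (b := u + l)) hI
  rwa [Real.volume_real_Ico_of_le (by linarith), add_sub_cancel_left] at this

/-- Halving the steps changes the value only on the right halves. These are 2^n intervals of length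
l/2^(n+1), and on each the jump is at most H times that length to the power α. -/
theorem hasBoundedOrbit_stepApprox_sub (hC : 0 ≤ C) (hθ : ∀ k, 0 ≤ θ k)
    (hInd : ∀ (J : Set ℝ) (hJ : J.OrdConnected), J ⊆ Icc 0 1 →
      HasBoundedOrbit ι U θ (indL1 J hJ) (C * volume.real J ^ (1 - s)))
    (hh : ∀ x ∈ D, ∀ y ∈ D, ‖h x - h y‖ ≤ H * |x - y| ^ α) (hDI : D ⊆ Icc 0 1) (n : ℕ) :
    ∀ {u l : ℝ}, 0 < l → Ico u (u + l) ⊆ D →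
      HasBoundedOrbit ι U θ (stepApprox h (n + 1) u l - stepApprox h n u l)
        (2 ^ n * (H * (l / 2 ^ (n + 1)) ^ α * (C * (l / 2 ^ (n + 1)) ^ (1 - s)))) := by
  induction n with
  | zero =>
    intro u l hl hD
    obtain ⟨hD1, hD2⟩ := Ico_half_subset hl hD
    have e : stepApprox h (0 + 1) u l - stepApprox h 0 u l = (h (u + l / 2) - h u) •
        indL1 (Ico (u + l / 2) (u + l / 2 + l / 2)) ordConnected_Ico := by
      simp only [stepApprox]
      rw [indL1_Ico_split u hl, smul_add, sub_smul]
      abel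
    rw [e]
    refine ((hasBoundedOrbit_Ico hInd (half_pos hl) (hD2.trans hDI)).smul _).mono hθ ?_
    simp only [pow_zero, zero_add, pow_one, one_mul]
    refine mul_le_mul_of_nonneg_right ?_ (by positivity)
    have := hh (u + l / 2) (hD ⟨by linarith, by linarith⟩) u (hD ⟨le_rfl, by linarith⟩)
    rwa [add_sub_cancel_left, abs_of_pos (half_pos hl)] at this
  | succ n ih =>
    intro u l hl hD
    obtain ⟨hD1, hD2⟩ := Ico_half_subset hl hD
    have e : stepApprox h (n + 1 + 1) u l - stepApprox h (n + 1) u l =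
        (stepApprox h (n + 1) u (l / 2) - stepApprox h n u (l / 2)) +
        (stepApprox h (n + 1) (u + l / 2) (l / 2) - stepApprox h n (u + l / 2) (l / 2)) := by
      have e3 : ∀ m, stepApprox h (m + 1) u l =
          stepApprox h m u (l / 2) + stepApprox h m (u + l / 2) (l / 2) := fun _ => rfl
      rw [e3 (n + 1), e3 n]
      abel
    rw [e]
    refine ((ih (half_pos hl) hD1).add (ih (half_pos hl) hD2)).mono hθ (le_of_eq ?_)
    have e2 : l / 2 / 2 ^ (n + 1) = l / 2 ^ (n + 1 + 1) := by rw [pow_succ _ (n + 1)]; field_simp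
    rw [e2, pow_succ _ n]
    ring

theorem exists_hasBoundedOrbit_of_holder [CompleteSpace B] (hC : 0 ≤ C) (hθ : ∀ k, 0 ≤ θ k)
    (hInd : ∀ (J : Set ℝ) (hJ : J.OrdConnected), J ⊆ Icc 0 1 →
      HasBoundedOrbit ι U θ (indL1 J hJ) (C * volume.real J ^ (1 - s)))
    (hα : 0 < α) (hsα : s < α) (hH : 0 ≤ H)
    (hh : ∀ x ∈ D, ∀ y ∈ D, ‖h x - h y‖ ≤ H * |x - y| ^ α) (hDI : D ⊆ Icc 0 1)
    {u l : ℝ} (hl : 0 < l) (hD : Ico u (u + l) ⊆ D) {φ : L1I}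
    (hφ : φ =ᵐ[mI] (Ico u (u + l)).indicator h) :
    ∃ R, HasBoundedOrbit ι U θ φ R := by
  have h0 : HasBoundedOrbit ι U θ (stepApprox h 0 u l) (‖h u‖ * (C * l ^ (1 - s))) :=
    (hasBoundedOrbit_Ico hInd hl (hD.trans hDI)).smul _
  have hpow : ∀ (p : ℝ) (n : ℕ), (l / 2 ^ (n + 1)) ^ p = (l / 2) ^ p * ((1 / 2) ^ p) ^ n := by
    intro p n
    rw [← Real.rpow_natCast ((1 / 2 : ℝ) ^ p) n, ← Real.rpow_mul (by norm_num), mul_comm p,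
      Real.rpow_mul (by norm_num), ← Real.mul_rpow (by positivity) (by positivity),
      Real.rpow_natCast, pow_succ]
    congr 1
    rw [one_div, inv_pow]
    field_simp
  -- The ratio of the telescoping series is 2^(s-α): twice as many atoms, each with coefficient
  -- smaller by 2^(-α) and norm bound by 2^(s-1). This is where α > s enters.
  have hratio : 2 * ((1 / 2 : ℝ) ^ α * (1 / 2) ^ (1 - s)) < 1 := by
    rw [← Real.rpow_add (by norm_num)]
    have : (1 / 2 : ℝ) ^ (α + (1 - s)) < (1 / 2) ^ (1 : ℝ) :=
      Real.rpow_lt_rpow_of_exponent_gt (by norm_num) (by norm_num) (by linarith)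
    rw [Real.rpow_one] at this
    linarith
  have hsum : Summable fun n : ℕ =>
      2 ^ n * (H * (l / 2 ^ (n + 1)) ^ α * (C * (l / 2 ^ (n + 1)) ^ (1 - s))) := by
    refine ((summable_geometric_of_lt_one (by positivity) hratio).mul_left
      (H * (l / 2) ^ α * (C * (l / 2) ^ (1 - s)))).congr fun n => ?_
    rw [hpow, hpow, mul_pow, mul_pow]
    ring
  have hlim : Tendsto (fun m => ∑ n ∈ Finset.range m,
      (stepApprox h (n + 1) u l - stepApprox h n u l)) atTop (𝓝 (φ - stepApprox h 0 u l)) := by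
    simp only [Finset.sum_range_sub fun n => stepApprox h n u l]
    exact (tendsto_stepApprox hα hH hh hl hD hφ).sub_const _
  have h1 := HasBoundedOrbit.of_tendsto
    (fun n => hasBoundedOrbit_stepApprox_sub hC hθ hInd hh hDI n hl hD) hsum hlim
  have h2 := h1.add h0
  rw [sub_add_cancel] at h2
  exact ⟨_, h2⟩

end Hoelder

end TransferBesov

namespace TransferBesov

/-! ### Overlapping branches and kernel elements of the transfer operator. -/

section Branches

variable {β : ℝ} {N : ℕ} {a : Fin (N + 1) → ℝ} {T : ℝ → ℝ}

theorem image_piece_mem_nhds (hβ : 0 < β) (hT : IsPiecewiseDiffeo β a T) {i : Fin N} {z : ℝ}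
    (hz : z ∈ piece a i) : T '' piece a i ∈ 𝓝 (T z) := by
  obtain ⟨p, hp, hpz⟩ := exists_between hz.1
  obtain ⟨q, hzq, hq⟩ := exists_between hz.2
  have hpi : p ∈ piece a i := ⟨hp, hpz.trans hz.2⟩
  have hqi : q ∈ piece a i := ⟨hz.1.trans hzq, hq⟩
  have hsub : uIcc (T p) (T q) ⊆ T '' piece a i := by
    rw [← hT.image_uIcc hβ hpi hqi]
    exact image_mono (ordConnected_Ioo.uIcc_subset hpi hqi)
  refine mem_of_superset ?_ hsub
  rcases hT.strictMonoOn_or_strictAntiOn hβ i with h | h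
  · exact mem_of_superset (Icc_mem_nhds (h hpi hz hpz) (h hz hqi hzq)) Icc_subset_uIcc
  · exact mem_of_superset (Icc_mem_nhds (h hz hqi hzq) (h hpi hz hpz)) Icc_subset_uIcc'

/-- If `T` expands somewhere, then invariance of Lebesgue measure forces the images of two
different pieces to overlap on an open set. -/
theorem exists_common_image (hβ : 0 < β) (hT : IsPiecewiseDiffeo β a T)
    (hinv : PreservesLebesgue a T) (hexp : ∃ i, ∃ x ∈ piece a i, 1 < |deriv T x|) :
    ∃ i j, i ≠ j ∧ ∃ y, T '' piece a i ∩ T '' piece a j ∈ 𝓝 y := by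
  obtain ⟨i, x, hx, hd⟩ := hexp
  have hslope := (hasDerivAt_iff_tendsto_slope.1 (hT.differentiableAt hβ hx).hasDerivAt).abs
  have hev : ∀ᶠ d in 𝓝[≠] x, d ∈ piece a i := nhdsWithin_le_nhds (isOpen_Ioo.mem_nhds hx)
  -- A chord of slope above 1 in absolute value: the image of the segment from x to d is longer than
  -- the segment.
  obtain ⟨d, ⟨hds, hdi⟩, hdx⟩ :=
    (((hslope.eventually (lt_mem_nhds hd)).and hev).and self_mem_nhdsWithin).exists
  have hlt : |d - x| < |T d - T x| := by
    rwa [slope_def_field, abs_div, one_lt_div (abs_pos.2 (sub_ne_zero.2 hdx))] at hds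
  have hsub : uIcc x d ⊆ piece a i := ordConnected_Ioo.uIcc_subset hx hdi
  have himg := hT.image_uIcc hβ hx hdi
  have hA := hinv (uIcc (T x) (T d)) measurableSet_uIcc
    (ordConnected_Icc.uIcc_subset (hT.mapsTo i hx) (hT.mapsTo i hdi))
  -- By invariance the preimage of that image is too large to fit in the segment. A preimage point
  -- outside it lies in another piece, since T is injective on piece i.
  have hnot : ¬ (⋃ i, piece a i) ∩ T ⁻¹' uIcc (T x) (T d) ⊆ uIcc x d := by
    intro h
    have h1 := measure_mono (μ := volume) h
    rw [hA, Real.volume_interval, Real.volume_interval,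
      ENNReal.ofReal_le_ofReal_iff (abs_nonneg _)] at h1
    exact absurd hlt (not_lt.2 h1)
  obtain ⟨w, ⟨hwp, hwA⟩, hwn⟩ := not_subset.1 hnot
  obtain ⟨j, hj⟩ := mem_iUnion.1 hwp
  rw [mem_preimage, ← himg] at hwA
  obtain ⟨z, hz, hzw⟩ := hwA
  refine ⟨i, j, ?_, T w, inter_mem ?_ (image_piece_mem_nhds hβ hT hj)⟩
  · rintro rfl
    exact hwn (hT.injOn hβ i (hsub hz) hj hzw ▸ hz)
  · rw [← hzw]
    exact image_piece_mem_nhds hβ hT (hsub hz)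

theorem exists_image_Icc_eq (hβ : 0 < β) (hT : IsPiecewiseDiffeo β a T) {i : Fin N} {p q : ℝ}
    (hpq : p < q) (h : Icc p q ⊆ T '' piece a i) :
    ∃ u v, u < v ∧ Icc u v ⊆ piece a i ∧ T '' Icc u v = Icc p q := by
  obtain ⟨u, hu, rfl⟩ := h (left_mem_Icc.2 hpq.le)
  obtain ⟨v, hv, rfl⟩ := h (right_mem_Icc.2 hpq.le)
  have hne : u ≠ v := fun h => hpq.ne (congrArg T h)
  exact ⟨min u v, max u v, min_lt_max.2 hne, ordConnected_Ioo.uIcc_subset hu hv,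
    (hT.image_uIcc hβ hu hv).trans (uIcc_of_le hpq.le)⟩

theorem setIntegral_abs_deriv_mul_comp (hβ : 0 < β) (hT : IsPiecewiseDiffeo β a T) {i : Fin N}
    {u v p q : ℝ} (hsub : Icc u v ⊆ piece a i) (himg : T '' Icc u v = Icc p q) (g : ℝ → ℂ) :
    ∫ x in Icc u v, ((|deriv T x| : ℝ) : ℂ) * g (T x) = ∫ y in Icc p q, g y := by
  rw [← himg, integral_image_eq_integral_abs_deriv_smul measurableSet_Icc
    (fun x hx => (hT.differentiableAt hβ (hsub hx)).hasDerivAt.hasDerivWithinAt)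
    ((hT.injOn hβ i).mono hsub)]
  simp only [Complex.real_smul]

theorem mI_restrict_of_subset {A : Set ℝ} (hA : A ⊆ Icc 0 1) :
    mI.restrict A = volume.restrict A :=
  Measure.restrict_restrict_of_subset hA

theorem exists_L1_abs_deriv (hβ : 0 < β) (hT : IsPiecewiseDiffeo β a T) {i : Fin N} {u v : ℝ}
    (hsub : Icc u v ⊆ piece a i) :
    ∃ φ : L1I, φ =ᵐ[mI] (Icc u v).indicator fun x => ((|deriv T x| : ℝ) : ℂ) := by
  obtain ⟨c, M, -, hM, h⟩ := hT.exists_deriv_bounds hβ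
  have hm : Measurable fun x => ((|deriv T x| : ℝ) : ℂ) :=
    Complex.measurable_ofReal.comp (measurable_deriv T).abs
  have hi : Integrable ((Icc u v).indicator fun x => ((|deriv T x| : ℝ) : ℂ)) mI := by
    refine Integrable.of_bound (hm.indicator measurableSet_Icc).aestronglyMeasurable M
      (ae_of_all _ fun x => ?_)
    by_cases hx : x ∈ Icc u v
    · rw [indicator_of_mem hx, Complex.norm_real, Real.norm_eq_abs, abs_abs]
      exact (h i x (hsub hx)).2
    · rw [indicator_of_notMem hx, norm_zero]
      exact hM.le
  exact ⟨hi.toL1 _, hi.coeFn_toL1⟩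

/-- The right side does not depend on the branch: |DT| on any interval mapped onto [p,q] has
transfer image 1_[p,q]. -/
theorem integral_mul_comp_of_ae_eq (hβ : 0 < β) (hT : IsPiecewiseDiffeo β a T) {i : Fin N}
    {u v p q : ℝ} (hsub : Icc u v ⊆ piece a i) (himg : T '' Icc u v = Icc p q) {φ : L1I}
    (hφ : φ =ᵐ[mI] (Icc u v).indicator fun x => ((|deriv T x| : ℝ) : ℂ)) (g : ℝ → ℂ) :
    ∫ x, φ x * g (T x) ∂mI = ∫ y in Icc p q, g y := by
  rw [← setIntegral_abs_deriv_mul_comp hβ hT hsub himg,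
    ← mI_restrict_of_subset (hsub.trans (hT.piece_subset i)),
    ← integral_indicator (μ := mI) measurableSet_Icc]
  refine integral_congr_ae ?_
  filter_upwards [hφ] with x hx
  rw [hx]
  by_cases h : x ∈ Icc u v <;> simp [h]

/-- The difference of two branches over the same interval is killed by the transfer operator. -/
theorem isTransferImage_sub_zero (hβ : 0 < β) (hT : IsPiecewiseDiffeo β a T) {i j : Fin N}
    (hinv : PreservesLebesgue a T)
    {u v u' v' p q : ℝ} (hsub : Icc u v ⊆ piece a i) (himg : T '' Icc u v = Icc p q)
    (hsub' : Icc u' v' ⊆ piece a j) (himg' : T '' Icc u' v' = Icc p q) {φ φ' : L1I}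
    (hφ : φ =ᵐ[mI] (Icc u v).indicator fun x => ((|deriv T x| : ℝ) : ℂ))
    (hφ' : φ' =ᵐ[mI] (Icc u' v').indicator fun x => ((|deriv T x| : ℝ) : ℂ)) :
    IsTransferImage T (φ - φ') 0 := by
  intro g hg hb
  obtain ⟨F, hF, hFT⟩ := exists_measurePreserving hβ hT hinv
  have hint : ∀ f : L1I, Integrable (fun x => f x * g (T x)) mI := fun f => by
    refine (integrable_mul_bounded f (hg.comp hF.measurable) (hb.imp fun M h x => h _)).congr ?_
    filter_upwards [ae_mem_pieces hT hinv] with x hx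
    rw [Function.comp_apply, hFT hx]
  have h0 : ∫ x, (0 : L1I) x * g x ∂mI = 0 := by
    refine integral_eq_zero_of_ae ?_
    filter_upwards [Lp.coeFn_zero ℂ 1 mI] with x hx
    rw [hx, Pi.zero_apply, zero_mul]
  have h1 : ∫ x, (φ - φ' : L1I) x * g (T x) ∂mI =
      ∫ x, (φ x * g (T x) - φ' x * g (T x)) ∂mI := by
    refine integral_congr_ae ?_
    filter_upwards [Lp.coeFn_sub φ φ'] with x hx
    rw [hx, Pi.sub_apply, sub_mul]
  rw [h0, h1, integral_sub (hint φ) (hint φ'), integral_mul_comp_of_ae_eq hβ hT hsub himg hφ,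
    integral_mul_comp_of_ae_eq hβ hT hsub' himg' hφ', sub_self]

/-- Integration over a set, as a linear functional on `L¹(I)`. -/
noncomputable def setIntegralₗ (A : Set ℝ) : L1I →ₗ[ℂ] ℂ where
  toFun f := ∫ x in A, f x ∂mI
  map_add' f g := by
    rw [← integral_add (L1.integrable_coeFn f).integrableOn (L1.integrable_coeFn g).integrableOn]
    exact integral_congr_ae (ae_restrict_of_ae (Lp.coeFn_add f g))
  map_smul' c f := by
    rw [RingHom.id_apply, ← integral_smul]
    exact integral_congr_ae (ae_restrict_of_ae (Lp.coeFn_smul c f))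

theorem exists_disjoint_Icc {W : Set ℝ} {y : ℝ} (hW : W ∈ 𝓝 y) :
    ∃ p q : ℕ → ℝ, (∀ n, p n < q n) ∧ (∀ n, Icc (p n) (q n) ⊆ W) ∧
      Pairwise fun m n => Disjoint (Icc (p m) (q m)) (Icc (p n) (q n)) := by
  obtain ⟨ε, hε, hb⟩ := Metric.mem_nhds_iff.1 hW
  -- The n-th interval joins terms 2n+1 and 2n of this decreasing sequence; the shift by 2 keeps
  -- even the first term within distance ε of y.
  have ht : StrictAnti fun n : ℕ => y + ε / (n + 2) := fun m n hmn => by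
    have : (m : ℝ) < n := by exact_mod_cast hmn
    dsimp only
    gcongr
  refine ⟨fun n => y + ε / ((2 * n + 1 : ℕ) + 2), fun n => y + ε / ((2 * n : ℕ) + 2),
    fun n => ht (Nat.lt_succ_self _), fun n x hx => hb ?_, ?_⟩
  · have h1 : y < x := lt_of_lt_of_le (by simp only [lt_add_iff_pos_right]; positivity) hx.1
    have h2 : ε / (((2 * n : ℕ) : ℝ) + 2) < ε := by
      apply div_lt_self hε
      have : (0 : ℝ) ≤ ((2 * n : ℕ) : ℝ) := Nat.cast_nonneg _
      linarith
    rw [Metric.mem_ball, Real.dist_eq, abs_of_pos (sub_pos.2 h1)]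
    linarith [hx.2]
  · have key : ∀ m n : ℕ, m < n → Disjoint
        (Icc (y + ε / (((2 * m + 1 : ℕ) : ℝ) + 2)) (y + ε / (((2 * m : ℕ) : ℝ) + 2)))
        (Icc (y + ε / (((2 * n + 1 : ℕ) : ℝ) + 2)) (y + ε / (((2 * n : ℕ) : ℝ) + 2))) := by
      intro m n hmn
      rw [Set.disjoint_left]
      intro x hx hx'
      have := ht (show 2 * m + 1 < 2 * n by omega)
      exact absurd (hx.1.trans hx'.2) (not_le.2 this)
    intro m n hmn
    rcases hmn.lt_or_gt with h | h
    · exact key m n h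
    · exact (key n m h).symm

end Branches

/-! ### Eigenvectors from bounded orbits, and the essential spectral radius. -/

section Spectrum

variable {B E : Type*} [NormedAddCommGroup B] [NormedSpace ℂ B] [CompleteSpace B]
  [NormedAddCommGroup E] [NormedSpace ℂ E] {ι : B →L[ℂ] E} {U : E →L[ℂ] E} {L : B →L[ℂ] B}
  {θ : ℕ → ℝ} {f : E} {R : ℝ}

/-- If `L` is a left inverse of `U` and kills `f`, then `∑ z^k U^k f` is an eigenvector of `L`. -/
theorem exists_eigenvector (hι : Function.Injective ι) (hLU : ∀ b f, ι b = U f → ι (L b) = f)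
    (hker : ∀ b, ι b = f → L b = 0) (hf : HasBoundedOrbit ι U θ f R) {z : ℂ}
    (hz : Summable fun k => ‖z‖ ^ k * θ k) :
    ∃ v, L v = z • v ∧ ι v - z • U (ι v) = f := by
  choose b hb hbr using hf
  have hs : Summable fun k => z ^ k • b k := by
    refine .of_norm_bounded (hz.mul_left R) fun k => ?_
    rw [norm_smul, norm_pow]
    calc ‖z‖ ^ k * ‖b k‖ ≤ ‖z‖ ^ k * (R * θ k) :=
          mul_le_mul_of_nonneg_left (hbr k) (by positivity)
      _ = R * (‖z‖ ^ k * θ k) := by ring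
  have hL0 : L (b 0) = 0 := hker _ (by simpa using hb 0)
  have hLs : ∀ k, L (b (k + 1)) = b k := fun k => hι <| by
    rw [hb k]
    exact hLU _ _ (by rw [hb (k + 1), pow_succ']; rfl)
  refine ⟨∑' k, z ^ k • b k, ?_, ?_⟩
  · rw [L.map_tsum hs, (hs.mapL L).tsum_eq_zero_add]
    simp only [map_smul, hL0, hLs, smul_zero, zero_add, pow_succ', mul_smul]
    exact tsum_const_smul'' z
  · have hs' := hs.mapL ι
    have hsU := hs'.mapL U
    rw [ι.map_tsum hs, U.map_tsum hs', hs'.tsum_eq_zero_add, ← tsum_const_smul'' z]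
    -- Each later term of the series is z U applied to the preceding one, so the difference
    -- telescopes to the zeroth term f.
    have e : ∀ k, ι (z ^ (k + 1) • b (k + 1)) = z • U (ι (z ^ k • b k)) := fun k => by
      rw [map_smul, map_smul, map_smul, hb, hb, pow_succ' U, pow_succ' z, mul_smul]
      rfl
    simp only [e, add_sub_cancel_right]
    rw [pow_zero, one_smul, hb 0]
    rfl

theorem summable_pow_mul_of_tendsto {u : ℕ → ℝ} (hu : ∀ k, 0 ≤ u k) {r t : ℝ} (ht : 0 ≤ t)
    (hr : 0 < r) (hlim : Tendsto (fun k : ℕ => u k ^ (1 / (k : ℝ))) atTop (𝓝 r))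
    (htr : t < 1 / r) : Summable fun k => t ^ k * u k := by
  have h1 : t * r < 1 := (lt_div_iff₀ hr).1 htr
  -- Eventually u k ≤ ρ^k, so the geometric series of ratio tρ < 1 dominates.
  obtain ⟨ρ, hrρ, hρ⟩ : ∃ ρ, r < ρ ∧ t * ρ < 1 := by
    rcases ht.eq_or_lt with rfl | ht'
    · exact ⟨r + 1, by linarith, by simp⟩
    · obtain ⟨ρ, h2, h3⟩ := exists_between ((lt_div_iff₀' ht').2 h1)
      exact ⟨ρ, h2, (lt_div_iff₀' ht').1 h3⟩
  have hρ0 : 0 ≤ ρ := (hr.trans hrρ).le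
  refine .of_norm_bounded_eventually_nat
    (summable_geometric_of_lt_one (mul_nonneg ht hρ0) hρ) ?_
  filter_upwards [hlim.eventually (gt_mem_nhds hrρ), eventually_ne_atTop 0] with k hk hk0
  rw [Real.norm_of_nonneg (mul_nonneg (pow_nonneg ht k) (hu k)), mul_pow]
  refine mul_le_mul_of_nonneg_left ?_ (pow_nonneg ht k)
  have := pow_le_pow_left₀ (Real.rpow_nonneg (hu k) _) hk.le k
  rwa [one_div, Real.rpow_inv_natCast_pow (hu k) hk0] at this

end Spectrum

/-- A Fredholm operator has finite-dimensional kernel. It is enough to test nonnegative real z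
approaching r. -/
theorem ofReal_le_essSpectralRadius {B : Type*} [NormedAddCommGroup B] [NormedSpace ℂ B]
    {L : B →L[ℂ] B} {r : ℝ}
    (h : ∀ z : ℂ, ‖z‖ < r → ¬ FiniteDimensional ℂ (Module.End.eigenspace (L : B →ₗ[ℂ] B) z)) :
    ENNReal.ofReal r ≤ essSpectralRadius L := by
  refine le_of_forall_lt fun c hc => ?_
  obtain ⟨c', hcc', hc'⟩ := exists_between hc
  have hfin : c' ≠ ∞ := (hc'.trans ENNReal.ofReal_lt_top).ne
  lift c' to NNReal using hfin
  have hlt : ‖((c' : ℝ) : ℂ)‖ < r := by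
    rw [Complex.norm_real, NNReal.norm_eq]
    exact ENNReal.coe_lt_ofReal.1 hc'
  refine hcc'.trans_le ?_
  have hnf : ((c' : ℝ) : ℂ) ∈
      {z : ℂ | ¬ (z • ContinuousLinearMap.id ℂ B - L).IsFredholm} := by
    intro hfr
    refine h _ hlt ?_
    have hk := hfr.finite_ker
    have e : Module.End.eigenspace (L : B →ₗ[ℂ] B) ((c' : ℝ) : ℂ) =
        (((c' : ℝ) : ℂ) • ContinuousLinearMap.id ℂ B - L).ker := by
      ext v
      rw [Module.End.mem_eigenspace_iff]
      constructor
      · intro hv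
        have : ((c' : ℝ) : ℂ) • v - L v = 0 := sub_eq_zero.2 hv.symm
        exact this
      · intro hv
        have : ((c' : ℝ) : ℂ) • v - L v = 0 := hv
        exact (sub_eq_zero.1 this).symm
    rw [e]
    exact hk
  refine le_trans ?_ (le_iSup₂ (f := fun (z : ℂ)
    (_ : z ∈ {z : ℂ | ¬ (z • ContinuousLinearMap.id ℂ B - L).IsFredholm}) =>
      ((‖z‖₊ : NNReal) : ℝ≥0∞)) _ hnf)
  rw [ENNReal.coe_le_coe, ← NNReal.coe_le_coe, coe_nnnorm, Complex.norm_real, NNReal.norm_eq]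

end TransferBesov

namespace TransferBesov

/-! ### The Besov embedding and the infinite-dimensional eigenspaces. -/

section Main

variable {β : ℝ} {N : ℕ} {a : Fin (N + 1) → ℝ} {T : ℝ → ℝ}
  {B : Type*} [NormedAddCommGroup B] [NormedSpace ℂ B] {ι : B →L[ℂ] L1I} {s C : ℝ}

theorem exists_lift_besov [CompleteSpace B] (hι : Function.Injective ι) (hC : 0 ≤ C) (hs1 : s < 1)
    (hJ : ∀ (J : Set ℝ) (hJ : J.OrdConnected), J ⊆ Icc 0 1 →
      ∃ b : B, ι b = indL1 J hJ ∧ ‖b‖ ≤ C * volume.real J ^ (1 - s)) :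
    ∃ K : ℝ, ∀ ψ ∈ besov s, ∃ b : B, ι b = ψ ∧ ‖b‖ ≤ K * besovNorm s ψ := by
  have key : ∀ ψ c Q, IsAtomicRep s ψ c Q → ∃ b : B, ι b = ψ ∧ ‖b‖ ≤ C * ∑' n, ‖c n‖ := by
    intro ψ c Q h
    rw [← tsum_mul_left]
    refine exists_lift_of_tendsto (h.summable.mul_left C) (fun n => ?_) h.tendsto
    obtain ⟨b, hb, hbn⟩ := hJ (Q n) (h.ordConnected n) (h.subset n)
    refine ⟨(c n * ((volume.real (Q n) ^ (s - 1) : ℝ) : ℂ)) • b, by rw [map_smul, hb], ?_⟩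
    have h0 : 0 ≤ volume.real (Q n) := measureReal_nonneg
    have h1 : volume.real (Q n) ^ (s - 1) * volume.real (Q n) ^ (1 - s) ≤ 1 := by
      -- For an interval of length 0 the product is 0, whatever the value of 0^(s-1).
      rcases h0.eq_or_lt with h0 | h0
      · rw [← h0, Real.zero_rpow (sub_pos.2 hs1).ne', mul_zero]
        exact zero_le_one
      · rw [← Real.rpow_add h0, sub_add_sub_cancel, sub_self, Real.rpow_zero]
    rw [norm_smul, norm_mul, Complex.norm_real, Real.norm_of_nonneg (Real.rpow_nonneg h0 _)]
    calc ‖c n‖ * volume.real (Q n) ^ (s - 1) * ‖b‖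
        ≤ ‖c n‖ * volume.real (Q n) ^ (s - 1) * (C * volume.real (Q n) ^ (1 - s)) :=
          mul_le_mul_of_nonneg_left hbn (by positivity)
      _ = C * ‖c n‖ * (volume.real (Q n) ^ (s - 1) * volume.real (Q n) ^ (1 - s)) := by ring
      _ ≤ C * ‖c n‖ := mul_le_of_le_one_right (by positivity) h1
  -- The constant C + 1 rather than C permits division when C = 0.
  refine ⟨C + 1, fun ψ ⟨c, Q, h⟩ => ?_⟩
  obtain ⟨b, hb, -⟩ := key ψ c Q h
  refine ⟨b, hb, ?_⟩
  have hC1 : 0 < C + 1 := by linarith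
  rw [← div_le_iff₀' hC1]
  refine le_csInf ⟨_, c, Q, h, rfl⟩ ?_
  rintro _ ⟨c', Q', h', rfl⟩
  obtain ⟨b', hb', hbn'⟩ := key ψ c' Q' h'
  -- Injectivity of `ι` makes the lift independent of the representation, so its norm is bounded
  -- through the infimum.
  rw [hι (hb.trans hb'.symm), div_le_iff₀' hC1]
  refine hbn'.trans (mul_le_mul_of_nonneg_right (by linarith) (tsum_nonneg fun _ => norm_nonneg _))

theorem hasBoundedOrbit_indL1 (hβ : 0 < β) (hT : IsPiecewiseDiffeo β a T)
    (hinv : PreservesLebesgue a T) {F : ℝ → ℝ} (hF : MeasurePreserving F mI mI)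
    (hFT : EqOn F T (⋃ i, piece a i)) (hC : 0 ≤ C) (hs1 : s < 1)
    (hJ : ∀ (J : Set ℝ) (hJ : J.OrdConnected), J ⊆ Icc 0 1 →
      ∃ b : B, ι b = indL1 J hJ ∧ ‖b‖ ≤ C * volume.real J ^ (1 - s))
    (Q : Set ℝ) (hQ : Q.OrdConnected) (hQI : Q ⊆ Icc 0 1) :
    HasBoundedOrbit ι (koopman hF).toContinuousLinearMap (Theta a T (1 - s)) (indL1 Q hQ)
      (C * volume.real Q ^ (1 - s)) := by
  intro k
  rw [FunLike.coe_pow_eq_iterate]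
  change ∃ b, ι b = (koopman hF)^[k] (indL1 Q hQ) ∧ _
  rw [koopman_iterate_indL1 hβ hT hinv hF hFT hQ hQI k]
  obtain ⟨b, hb, hbn⟩ := exists_lift_sum (ι := ι) (Finset.univ : Finset (Fin k → Fin N))
    (ψ := fun w => indL1 (cylinder a T w ∩ T^[k] ⁻¹' Q) (ordConnected_cylinder_inter hβ hT hQ w))
    (fun w => hJ _ _ fun x hx => hx.1.1)
  refine ⟨b, hb, hbn.trans ?_⟩
  rw [← Finset.mul_sum, mul_assoc, mul_comm (volume.real Q ^ (1 - s))]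
  exact mul_le_mul_of_nonneg_left (sum_volume_real_rpow_le hβ hT hQ hQI (sub_pos.2 hs1) k) hC

theorem exists_L1_abs_deriv_hasBoundedOrbit [CompleteSpace B] (hβ : 0 < β)
    (hT : IsPiecewiseDiffeo β a T) {U : L1I →L[ℂ] L1I} {θ : ℕ → ℝ} (hθ : ∀ k, 0 ≤ θ k)
    (hC : 0 ≤ C) (hs1 : s < 1) (hsβ : s < β)
    (hInd : ∀ (J : Set ℝ) (hJ : J.OrdConnected), J ⊆ Icc 0 1 →
      HasBoundedOrbit ι U θ (indL1 J hJ) (C * volume.real J ^ (1 - s)))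
    {i : Fin N} {u v : ℝ} (huv : u < v) (hsub : Icc u v ⊆ piece a i) :
    ∃ φ : L1I, (φ =ᵐ[mI] (Icc u v).indicator fun x => ((|deriv T x| : ℝ) : ℂ)) ∧
      ∃ R, HasBoundedOrbit ι U θ φ R := by
  obtain ⟨φ, hφ⟩ := exists_L1_abs_deriv hβ hT hsub
  obtain ⟨α, H, hsα, hα, hH, hh⟩ := hT.exists_holder hβ hs1 hsβ i
  refine ⟨φ, hφ, ?_⟩
  have huv' : u + (v - u) = v := by ring
  refine exists_hasBoundedOrbit_of_holder (h := fun x => ((|deriv T x| : ℝ) : ℂ)) hC hθ hInd hα hsα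
    hH (fun x hx y hy => ?_) (hT.piece_subset i) (sub_pos.2 huv) (D := piece a i)
    (u := u) ?_ ?_
  · rw [← Complex.ofReal_sub, Complex.norm_real]
    exact hh x hx y hy
  · rw [huv']
    exact Ico_subset_Icc_self.trans hsub
  · rw [huv']
    exact hφ.trans (indicator_ae_eq_of_ae_eq_set Ico_ae_eq_Icc.symm)

theorem not_finiteDimensional_eigenspace [CompleteSpace B] (hβ : 0 < β)
    (hT : IsPiecewiseDiffeo β a T) (hinv : PreservesLebesgue a T) (hι : Function.Injective ι)
    {L : B →L[ℂ] B} (hL : ∀ b : B, IsTransferImage T (ι b) (ι (L b))) (hs1 : s < 1) (hC : 0 ≤ C)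
    (hJ : ∀ (J : Set ℝ) (hJ : J.OrdConnected), J ⊆ Icc 0 1 →
      ∃ b : B, ι b = indL1 J hJ ∧ ‖b‖ ≤ C * volume.real J ^ (1 - s))
    (hsβ : s < β) (hexp : ∃ i, ∃ x ∈ piece a i, 1 < |deriv T x|) {z : ℂ}
    (hz : Summable fun k => ‖z‖ ^ k * Theta a T (1 - s) k) :
    ¬ FiniteDimensional ℂ (Module.End.eigenspace (L : B →ₗ[ℂ] B) z) := by
  obtain ⟨F, hF, hFT⟩ := exists_measurePreserving hβ hT hinv
  obtain ⟨i, j, hij, y, hW⟩ := exists_common_image hβ hT hinv hexp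
  obtain ⟨p, q, hpq, hpqW, hdisj⟩ := exists_disjoint_Icc hW
  choose u v huv hsub himg using fun n =>
    exists_image_Icc_eq hβ hT (hpq n) ((hpqW n).trans inter_subset_left)
  choose u' v' huv' hsub' himg' using fun n =>
    exists_image_Icc_eq hβ hT (hpq n) ((hpqW n).trans inter_subset_right)
  have hInd := hasBoundedOrbit_indL1 (ι := ι) hβ hT hinv hF hFT hC hs1 hJ
  choose φ hφ R hR using fun n => exists_L1_abs_deriv_hasBoundedOrbit hβ hT
    (Theta_nonneg (1 - s)) hC hs1 hsβ hInd (huv n) (hsub n)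
  choose φ' hφ' R' hR' using fun n => exists_L1_abs_deriv_hasBoundedOrbit hβ hT
    (Theta_nonneg (1 - s)) hC hs1 hsβ hInd (huv' n) (hsub' n)
  have hLU : ∀ b f, ι b = (koopman hF).toContinuousLinearMap f → ι (L b) = f := fun b f h => by
    refine (hL b).unique ?_
    rw [h]
    exact isTransferImage_koopman hT hinv hF hFT f
  have hker : ∀ n b, ι b = φ n - φ' n → L b = 0 := fun n b h => hι <| by
    rw [map_zero]
    refine (hL b).unique ?_
    rw [h]
    exact isTransferImage_sub_zero hβ hT hinv (hsub n) (himg n) (hsub' n) (himg' n) (hφ n) (hφ' n)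
  choose w hw hwf using fun n => exists_eigenvector hι hLU (hker n) ((hR n).sub (hR' n)) hz
  -- These integrals form a diagonal matrix: the second branch lies in a different piece, and first
  -- branches with different indices are disjoint because their images are.
  have hval : ∀ m n, setIntegralₗ (Icc (u m) (v m)) (φ n - φ' n) =
      if m = n then ((q m - p m : ℝ) : ℂ) else 0 := by
    intro m n
    have hI : Icc (u m) (v m) ⊆ Icc 0 1 := (hsub m).trans (hT.piece_subset i)
    change ∫ x in Icc (u m) (v m), (φ n - φ' n : L1I) x ∂mI = _
    have hae : ∀ᵐ x ∂mI.restrict (Icc (u m) (v m)), (φ n - φ' n : L1I) x =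
        (Icc (u n) (v n)).indicator (fun x => ((|deriv T x| : ℝ) : ℂ)) x := by
      filter_upwards [ae_restrict_mem measurableSet_Icc, ae_restrict_of_ae (hφ n),
        ae_restrict_of_ae (hφ' n), ae_restrict_of_ae (Lp.coeFn_sub (φ n) (φ' n))]
        with x hx h1 h2 h3
      have hx' : x ∉ Icc (u' n) (v' n) := fun h =>
        hij (hT.eq_of_mem_piece (hsub m hx) (hsub' n h))
      rw [h3, Pi.sub_apply, h1, h2, indicator_of_notMem hx', sub_zero]
    rw [integral_congr_ae hae, mI_restrict_of_subset hI]
    split_ifs with hmn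
    · subst hmn
      have h1 := setIntegral_abs_deriv_mul_comp hβ hT (hsub m) (himg m) fun _ => 1
      simp only [mul_one] at h1
      rw [setIntegral_congr_fun measurableSet_Icc fun x hx => indicator_of_mem hx _, h1]
      simp [Real.volume_real_Icc_of_le (hpq m).le]
    · refine setIntegral_eq_zero_of_forall_eq_zero fun x hx => indicator_of_notMem (fun hx' => ?_) _
      have hd : Disjoint (Icc (p m) (q m)) (Icc (p n) (q n)) := hdisj hmn
      refine hd.notMem_of_mem_left (a := T x) ?_ ?_
      · rw [← himg m]
        exact mem_image_of_mem T hx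
      · rw [← himg n]
        exact mem_image_of_mem T hx'
  intro hfin
  -- v ↦ v - z U v recovers the kernel element from its eigenvector, so the integrals composed with
  -- `G` are, after scaling, dual to the eigenvectors.
  let G : B →ₗ[ℂ] L1I := (ι : B →ₗ[ℂ] L1I) -
    z • ((koopman hF).toContinuousLinearMap : L1I →ₗ[ℂ] L1I) ∘ₗ (ι : B →ₗ[ℂ] L1I)
  have hG : ∀ n, G (w n) = φ n - φ' n := hwf
  let e : ℕ → Module.End.eigenspace (L : B →ₗ[ℂ] B) z := fun n =>
    ⟨w n, Module.End.mem_eigenspace_iff.2 (hw n)⟩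
  let ξ : ℕ → Module.Dual ℂ (Module.End.eigenspace (L : B →ₗ[ℂ] B) z) := fun m =>
    (((q m - p m : ℝ) : ℂ)⁻¹ • (setIntegralₗ (Icc (u m) (v m))) ∘ₗ G) ∘ₗ Submodule.subtype _
  have hξ : ∀ m n, ξ m (e n) = ((q m - p m : ℝ) : ℂ)⁻¹ *
      if m = n then ((q m - p m : ℝ) : ℂ) else 0 := fun m n => by
    rw [← hval, ← hG]
    rfl
  have hli : LinearIndependent ℂ e := by
    refine LinearIndependent.of_pairwise_dual_eq_zero_one e ξ (fun m n hmn => ?_) fun n => ?_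
    · change ξ m (e n) = 0
      rw [hξ, if_neg hmn, mul_zero]
    · rw [hξ, if_pos rfl]
      exact inv_mul_cancel₀ (by exact_mod_cast (sub_pos.2 (hpq n)).ne')
  exact absurd hli.finite (by simpa using not_finite_iff_infinite.2 (inferInstance : Infinite ℕ))

end Main

end TransferBesov

theorem theoremA
    {β : ℝ} (hβ : 0 < β) {N : ℕ} (a : Fin (N + 1) → ℝ) (T : ℝ → ℝ)
    (hT : TransferBesov.IsPiecewiseDiffeo β a T)
    (hinv : TransferBesov.PreservesLebesgue a T)
    {B : Type*} [NormedAddCommGroup B] [NormedSpace ℂ B] [CompleteSpace B]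
    (ι : B →L[ℂ] TransferBesov.L1I) (hι : Function.Injective ι)
    (L : B →L[ℂ] B) (hL : ∀ b : B, TransferBesov.IsTransferImage T (ι b) (ι (L b)))
    {s C : ℝ} (hs0 : 0 < s) (hs1 : s < 1) (hC : 0 ≤ C)
    (hJ : ∀ (J : Set ℝ) (hJ : J.OrdConnected), J ⊆ Set.Icc 0 1 →
      ∃ b : B, ι b = TransferBesov.indL1 J hJ ∧
        ‖b‖ ≤ C * MeasureTheory.volume.real J ^ (1 - s)) :
    (∃ K : ℝ, ∀ ψ ∈ TransferBesov.besov s,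
      ∃ b : B, ι b = ψ ∧ ‖b‖ ≤ K * TransferBesov.besovNorm s ψ) ∧
    Filter.Tendsto (fun k : ℕ => TransferBesov.Theta a T (1 - s) k ^ (1 / (k : ℝ))) Filter.atTop
      (nhds (TransferBesov.ThetaInf a T (1 - s))) ∧
    0 < TransferBesov.ThetaInf a T (1 - s) ∧
    (s < β → (∃ i, ∃ x ∈ TransferBesov.piece a i, 1 < |deriv T x|) →
      ENNReal.ofReal (1 / TransferBesov.ThetaInf a T (1 - s)) ≤
          TransferBesov.essSpectralRadius L ∧
      ∀ z : ℂ, ‖z‖ < 1 / TransferBesov.ThetaInf a T (1 - s) →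
        Module.End.HasEigenvalue (L : B →ₗ[ℂ] B) z ∧
        ¬ FiniteDimensional ℂ (Module.End.eigenspace (L : B →ₗ[ℂ] B) z)) := by
  obtain ⟨r, hr, hlim⟩ := TransferBesov.exists_tendsto_Theta hβ hT hinv (sub_pos.2 hs1).le
  have hr' : TransferBesov.ThetaInf a T (1 - s) = r := hlim.limUnder_eq
  rw [hr']
  refine ⟨TransferBesov.exists_lift_besov hι hC hs1 hJ, hlim, hr, fun hsβ hexp => ?_⟩
  have hinf : ∀ z : ℂ, ‖z‖ < 1 / r →
      ¬ FiniteDimensional ℂ (Module.End.eigenspace (L : B →ₗ[ℂ] B) z) := fun z hz =>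
    TransferBesov.not_finiteDimensional_eigenspace hβ hT hinv hι hL hs1 hC hJ hsβ hexp
      (TransferBesov.summable_pow_mul_of_tendsto (TransferBesov.Theta_nonneg (1 - s))
        (norm_nonneg z) hr hlim hz)
  refine ⟨TransferBesov.ofReal_le_essSpectralRadius hinf, fun z hz => ⟨?_, hinf z hz⟩⟩
  intro h0
  refine hinf z hz ?_
  rw [show Module.End.eigenspace (L : B →ₗ[ℂ] B) z = ⊥ from h0]
  infer_instance
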